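/- **Setting.** Let $\Omega=(0,\ell_1)\times(0,\ell_2)$ with $\ell_1,\ell_2>0$, divided into $N_x\times N_y$ congruent rectangles $K\in\mathcal T_h$ of diameter at most $h$, where $N_x,N_y$ are positive and even. Nodes and edges on opposite sides of $\partial\Omega$ are identified periodically, so there are $N_xN_y$ nodes. All functions below are piecewise linear ($P_1$ on each $K$), and $a_h(u,v)=\sum_K\int_K\nabla u\cdot\nabla v$, $\|\cdot\|_0=\|\cdot\|_{L^2(\Omega)}$, $|v|_{1,h}=a_h(v,v)^{1/2}$. For a node $z$ let $\phi_z$ be the piecewise linear function whose value is $\tfrac12$ at the midpoints of the edges containing $z$ and $0$ at all other edge midpoints. Let $\psi_x$ (resp. $\psi_y$) be the piecewise linear function whose midpoint values are $\pm1$, alternating in both directions, on the vertical (resp. horizontal) edges and $0$ on the other edges. Put $\mathfrak B=\{\phi_1,\dots,\phi_{n}\}$, $n=N_xN_y$, $\mathfrak A=\{\psi_x,\psi_y\}$, $\mathfrak B^\flat=\{\phi_1,\dots,\phi_{n-1}\}$, $\mathfrak E=\mathfrak B\cup\mathfrak A$, $\mathfrak E^\flat=\mathfrak B^\flat\cup\mathfrak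 A$. The nodes are numbered so that the last two, $z_{n-1}$ and $z_n$, have opposite colours in the checkerboard (red/black) colouring of the nodes (true for the row-by-row numbering). Let $\mathbf S^{\mathfrak B}$, $\mathbf S^{\mathfrak B^\flat}$, $\mathbf S^{\mathfrak A}$ be the stiffness matrices, with entries $a_h(\chi_k,\chi_j)$ over the family concerned, and let $\mathbf{\tilde S}^{\mathfrak B^\flat}$ be $\mathbf S^{\mathfrak B^\flat}$ with every entry of its last row replaced by $1$. Let $f\in L^2(\Omega)$ with $\int_\Omega f=0$. A *Krylov solution* of $A\mathbf x=\mathbf b$ from $\mathbf x^{(0)}$ is a solution $\mathbf x$ with $\mathbf x-\mathbf x^{(0)}\in\operatorname{span}\{A^k(\mathbf b-A\mathbf x^{(0)}):k\ge0\}$. Consider the following discrete solutions. 1. $u_h$ is the combination of $\mathfrak E^\flat$ whose coefficient vector solves the system with matrix $\operatorname{diag}(\mathbf{\tilde S}^{\mathfrak B^\flat},\mathbf S^{\mathfrak A})$ and right-hand side $\int_\Omega f\,\mathfrak E^\flat$, with the entry of $\phi_{n-1}$ replaced by $0$. 2. $u_h^\flat$ is the combination of $\mathfrak E^\flat$ whose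 coefficient vector solves the system with matrix $\operatorname{diag}(\mathbf S^{\mathfrak B^\flat},\mathbf S^{\mathfrak A})$ and right-hand side $\int_\Omega f\,\mathfrak E^\flat$, and has $\mathfrak B^\flat$-coefficients summing to $0$. 3. $u_h^\natural$ is the combination of $\mathfrak E$ whose coefficient vector solves the system with matrix $\operatorname{diag}(\mathbf S^{\mathfrak B},\mathbf S^{\mathfrak A})$ and right-hand side $\int_\Omega f\,\mathfrak E$, and has $\mathfrak B$-coefficients summing to $0$. 4. $\bar u_h^\natural$ is the combination of $\mathfrak B$ whose coefficient vector is a Krylov solution of the system with matrix $\mathbf S^{\mathfrak B}$ and right-hand side $\int_\Omega f\,\mathfrak B$, from an initial vector with coefficients summing to $0$. **Theorem.** Each of the four functions $u_h,u_h^\flat,u_h^\natural,\bar u_h^\natural$ exists and is unique. The function $u_h^\flat$ is equally the one obtained from a Krylov solution $\mathbf u'$ of system 2 (from some initial vector) by post-processing: subtract from the $\mathfrak B^\flat$-coefficients of $\mathbf u'$ the multiple of $\mathbf w$ that makes their sum zero, where $\mathbf w$ is the coefficient vector of the constant function $1$ in $\mathfrak B^\flat$. Likewise $u_h^\natural$ is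 equally the one obtained from a Krylov solution of system 3 from an initial vector with $\mathfrak B$-coefficients summing to $0$. Moreover $$u_h=u_h^\flat=u_h^\natural,\qquad \|u_h^\natural-\bar u_h^\natural\|_0\le C h^2\|f\|_0,\qquad |u_h^\natural-\bar u_h^\natural|_{1,h}\le C h\|f\|_0,$$ with a constant $C>0$ that depends only on $\Omega$; in particular, not on $h$, $N_x$, $N_y$ or $f$. -/

import Mathlib

open MeasureTheory
open scoped Matrix

noncomputable section

/-- A uniform decomposition of `Ω = (0, ℓ₁) × (0, ℓ₂)` into `Nx × Ny` congruent rectangles. -/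
structure RectMesh (ℓ₁ ℓ₂ : ℝ) where
  Nx : ℕ
  Ny : ℕ
  Nx_pos : 0 < Nx
  Ny_pos : 0 < Ny

namespace RectMesh

variable {ℓ₁ ℓ₂ : ℝ} (M : RectMesh ℓ₁ ℓ₂)

instance : NeZero M.Nx := ⟨M.Nx_pos.ne'⟩
instance : NeZero M.Ny := ⟨M.Ny_pos.ne'⟩

/-- Mesh widths in the two directions. -/
def hx : ℝ := ℓ₁ / M.Nx
def hy : ℝ := ℓ₂ / M.Ny

/-- The (common) Euclidean diameter of the elements. -/
def diam : ℝ := Real.sqrt (M.hx ^ 2 + M.hy ^ 2)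

/-- The domain. -/
def dom (_ : RectMesh ℓ₁ ℓ₂) : Set (ℝ × ℝ) := Set.Ioo 0 ℓ₁ ×ˢ Set.Ioo 0 ℓ₂

/-- Elements; `(i, j)` stands for `(i hx, (i+1) hx) × (j hy, (j+1) hy)`. -/
abbrev Cell : Type := Fin M.Nx × Fin M.Ny

/-- Nodes after periodic identification; `(i, j)` stands for the class of `(i hx, j hy)`.
Addition in `Fin M.Nx` and `Fin M.Ny` wraps around, which is the periodic identification. -/
abbrev Node : Type := Fin M.Nx × Fin M.Ny

/-- The open rectangle belonging to an element. -/
def cellSet (K : M.Cell) : Set (ℝ × ℝ) :=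
  Set.Ioo ((K.1 : ℕ) * M.hx) (((K.1 : ℕ) + 1) * M.hx) ×ˢ
    Set.Ioo ((K.2 : ℕ) * M.hy) (((K.2 : ℕ) + 1) * M.hy)

/-- The polynomial `a + b x + c y` of degree at most one, given by `(a, b, c)`, at a point. -/
def evalP1 (p : ℝ × ℝ × ℝ) (z : ℝ × ℝ) : ℝ := p.1 + p.2.1 * z.1 + p.2.2 * z.2

/-- Piecewise linear functions: one polynomial of degree at most one per element. -/
abbrev Broken : Type := M.Cell → ℝ × ℝ × ℝ

/-- The function on the domain given by a piecewise linear function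
(with value `0` on the edges, a null set). -/
def toFun (v : M.Broken) (z : ℝ × ℝ) : ℝ :=
  ∑ K, (M.cellSet K).indicator (evalP1 (v K)) z

/-! ### The space of periodic nonconforming functions -/

/-- Average of a polynomial over the segment from `a` to `b`. -/
def edgeAvg (p : ℝ × ℝ × ℝ) (a b : ℝ × ℝ) : ℝ := ∫ t in (0 : ℝ)..1, evalP1 p (a + t • (b - a))

/-- Corners of an element. -/
def cornerSW (K : M.Cell) : ℝ × ℝ := ((K.1 : ℕ) * M.hx, (K.2 : ℕ) * M.hy)
def cornerSE (K : M.Cell) : ℝ × ℝ := (((K.1 : ℕ) + 1) * M.hx, (K.2 : ℕ) * M.hy)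
def cornerNW (K : M.Cell) : ℝ × ℝ := ((K.1 : ℕ) * M.hx, ((K.2 : ℕ) + 1) * M.hy)
def cornerNE (K : M.Cell) : ℝ × ℝ := (((K.1 : ℕ) + 1) * M.hx, ((K.2 : ℕ) + 1) * M.hy)

/-- Membership in the periodic space: the edge averages from the two sides of every interior edge
agree, and so do the averages over opposite boundary edges (the neighbour of the last element
in a row or column is the first one). -/
def IsPeriodic (v : M.Broken) : Prop :=
  ∀ i j,
    edgeAvg (v (i, j)) (M.cornerSE (i, j)) (M.cornerNE (i, j)) =
        edgeAvg (v (i + 1, j)) (M.cornerSW (i + 1, j)) (M.cornerNW (i + 1, j)) ∧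
      edgeAvg (v (i, j)) (M.cornerNW (i, j)) (M.cornerNE (i, j)) =
        edgeAvg (v (i, j + 1)) (M.cornerSW (i, j + 1)) (M.cornerSE (i, j + 1))

/-- The piecewise linear function with prescribed values at the edge midpoints.
The vertical edge `(i, j)` joins the nodes `(i, j)` and `(i, j+1)`; it is the left edge of the
element `(i, j)`. The horizontal edge `(i, j)` joins `(i, j)` and `(i+1, j)`; it is the bottom edge
of the element `(i, j)`. The values are attained if on each element the two values on the vertical
edges and the two values on the horizontal edges have the same sum (the dice rule). -/
def ofMidpoints (vert horiz : Fin M.Nx → Fin M.Ny → ℝ) : M.Broken := fun K =>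
  let l := vert K.1 K.2
  let r := vert (K.1 + 1) K.2
  let b := horiz K.1 K.2
  let t := horiz K.1 (K.2 + 1)
  let dx := (r - l) / M.hx
  let dy := (t - b) / M.hy
  ((l + r + b + t) / 4 - dx * (((K.1 : ℕ) + 1 / 2) * M.hx) - dy * (((K.2 : ℕ) + 1 / 2) * M.hy),
    dx, dy)

/-- The node-based function of `z`: midpoint value `1/2` on the edges containing `z` and `0` on
all the others. -/
def nodeFun (z : M.Node) : M.Broken :=
  M.ofMidpoints (fun i j => if z = (i, j) ∨ z = (i, j + 1) then 1 / 2 else 0)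
    (fun i j => if z = (i, j) ∨ z = (i + 1, j) then 1 / 2 else 0)

/-- The alternating functions. -/
def psiX : M.Broken := M.ofMidpoints (fun i j => (-1) ^ ((i : ℕ) + (j : ℕ))) (fun _ _ => 0)
def psiY : M.Broken := M.ofMidpoints (fun _ _ => 0) (fun i j => (-1) ^ ((i : ℕ) + (j : ℕ)))

/-- The complementary family `ψ_x, ψ_y`. -/
def psi : Fin 2 → M.Broken := ![M.psiX, M.psiY]

lemma edgeAvg_eq (p : ℝ × ℝ × ℝ) (a b : ℝ × ℝ) :
    edgeAvg p a b = evalP1 p ((a.1 + b.1) / 2, (a.2 + b.2) / 2) := by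
  unfold edgeAvg evalP1
  have h : ∀ t : ℝ, p.1 + p.2.1 * (a + t • (b - a)).1 + p.2.2 * (a + t • (b - a)).2
      = (p.1 + p.2.1 * a.1 + p.2.2 * a.2)
        + (p.2.1 * (b.1 - a.1) + p.2.2 * (b.2 - a.2)) * t := by
    intro t; simp; ring
  simp_rw [h]
  have hi : IntervalIntegrable (fun t : ℝ => (p.2.1 * (b.1 - a.1) + p.2.2 * (b.2 - a.2)) * t)
      volume 0 1 := (by fun_prop : Continuous _).intervalIntegrable _ _
  rw [intervalIntegral.integral_add (by simp) hi, intervalIntegral.integral_const_mul]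
  simp
  ring

/-- Under the dice rule the prescribed values are the edge averages. -/
lemma edgeAvg_ofMidpoints (h1 : 0 < ℓ₁) (h2 : 0 < ℓ₂) {vert horiz : Fin M.Nx → Fin M.Ny → ℝ}
    (hd : ∀ i j, vert i j + vert (i + 1) j = horiz i j + horiz i (j + 1)) (i j) :
    edgeAvg (M.ofMidpoints vert horiz (i, j)) (M.cornerSW (i, j)) (M.cornerNW (i, j)) = vert i j ∧
    edgeAvg (M.ofMidpoints vert horiz (i, j)) (M.cornerSE (i, j)) (M.cornerNE (i, j)) =
      vert (i + 1) j ∧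
    edgeAvg (M.ofMidpoints vert horiz (i, j)) (M.cornerSW (i, j)) (M.cornerSE (i, j)) =
      horiz i j ∧
    edgeAvg (M.ofMidpoints vert horiz (i, j)) (M.cornerNW (i, j)) (M.cornerNE (i, j)) =
      horiz i (j + 1) := by
  have hx : M.hx ≠ 0 := (div_pos h1 (Nat.cast_pos.2 M.Nx_pos)).ne'
  have hy : M.hy ≠ 0 := (div_pos h2 (Nat.cast_pos.2 M.Ny_pos)).ne'
  have := hd i j
  simp only [edgeAvg_eq, evalP1, ofMidpoints, cornerSW, cornerNW, cornerSE, cornerNE]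
  refine ⟨?_, ?_, ?_, ?_⟩ <;> field_simp <;> linarith

lemma isPeriodic_ofMidpoints (h1 : 0 < ℓ₁) (h2 : 0 < ℓ₂) {vert horiz : Fin M.Nx → Fin M.Ny → ℝ}
    (hd : ∀ i j, vert i j + vert (i + 1) j = horiz i j + horiz i (j + 1)) :
    M.IsPeriodic (M.ofMidpoints vert horiz) := by
  intro i j
  have a := M.edgeAvg_ofMidpoints h1 h2 hd
  exact ⟨(a i j).2.1.trans (a (i + 1) j).1.symm, (a i j).2.2.2.trans (a i (j + 1)).2.2.1.symm⟩

lemma fin_add_one_ne {n : ℕ} [NeZero n] (hn : Even n) (i : Fin n) : i + 1 ≠ i := by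
  have := NeZero.pos n
  intro h
  have h' := congrArg Fin.val h
  rw [Fin.val_add, Fin.val_one', Nat.add_mod_mod] at h'
  obtain ⟨k, hk⟩ := hn
  have := i.2
  rcases Nat.lt_or_ge (i.val + 1) n with h3 | h3
  · rw [Nat.mod_eq_of_lt h3] at h'; omega
  · have : i.val + 1 = n := by omega
    rw [this, Nat.mod_self] at h'; omega

lemma neg_one_pow_fin_add_one {n : ℕ} [NeZero n] (hn : Even n) (i : Fin n) :
    (-1 : ℝ) ^ ((i + 1 : Fin n) : ℕ) = -(-1) ^ (i : ℕ) := by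
  have := NeZero.pos n
  have := i.2
  rw [Fin.val_add, Fin.val_one', Nat.add_mod_mod]
  rcases Nat.lt_or_ge (i.val + 1) n with h3 | h3
  · rw [Nat.mod_eq_of_lt h3, pow_succ]; ring
  · have h4 : i.val + 1 = n := by omega
    rw [h4, Nat.mod_self]
    have : (-1 : ℝ) ^ (i.val + 1) = 1 := by rw [h4]; exact hn.neg_one_pow
    rw [pow_succ] at this
    simp; linarith

lemma isPeriodic_nodeFun (h1 : 0 < ℓ₁) (h2 : 0 < ℓ₂) (hNx : Even M.Nx) (hNy : Even M.Ny)
    (z : M.Node) : M.IsPeriodic (M.nodeFun z) := by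
  refine M.isPeriodic_ofMidpoints h1 h2 fun i j => ?_
  have hi := fin_add_one_ne hNx i
  have hj := fin_add_one_ne hNy j
  obtain ⟨a, b⟩ := z
  simp only [Prod.mk.injEq]
  grind

lemma isPeriodic_psiX (h1 : 0 < ℓ₁) (h2 : 0 < ℓ₂) (hNx : Even M.Nx) : M.IsPeriodic M.psiX := by
  refine M.isPeriodic_ofMidpoints h1 h2 fun i j => ?_
  rw [pow_add, pow_add, neg_one_pow_fin_add_one hNx]; ring

lemma isPeriodic_psiY (h1 : 0 < ℓ₁) (h2 : 0 < ℓ₂) (hNy : Even M.Ny) : M.IsPeriodic M.psiY := by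
  refine M.isPeriodic_ofMidpoints h1 h2 fun i j => ?_
  rw [pow_add, pow_add, neg_one_pow_fin_add_one hNy]; ring

/-! ### Forms and norms -/

/-- The broken Dirichlet form `a_h`. -/
def energy (u v : M.Broken) : ℝ :=
  ∑ K, ∫ _ in M.cellSet K, ((u K).2.1 * (v K).2.1 + (u K).2.2 * (v K).2.2)

/-- The broken `H¹` seminorm. -/
def seminormH1 (v : M.Broken) : ℝ := Real.sqrt (M.energy v v)

/-- The `L²` norm over the domain. -/
def normL2 (g : ℝ × ℝ → ℝ) : ℝ := (eLpNorm g 2 (volume.restrict M.dom)).toReal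

/-- The load `∫_Ω f v`. -/
def load (f : ℝ × ℝ → ℝ) (v : M.Broken) : ℝ := ∫ z in M.dom, f z * M.toFun v z

/-- The two colour classes of the nodes; neighbouring nodes have different colours when both
numbers of subdivisions are even. -/
def color (z : M.Node) : ℕ := ((z.1 : ℕ) + (z.2 : ℕ)) % 2

/-! ### Stiffness matrices and linear systems

The family `𝔅` of the node-based functions is indexed by the nodes. `𝔅♭` is `𝔅` without the
function of one node `r` (the last one), and `s` is the last node of `𝔅♭`, in whose row the
zero-mean condition is imposed. -/

/-- The index set of `𝔅♭`. -/
abbrev FlatNode (r : M.Node) : Type := {z : M.Node // z ≠ r}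

def stiffB : Matrix M.Node M.Node ℝ :=
  Matrix.of fun j k => M.energy (M.nodeFun k) (M.nodeFun j)

def stiffFlat (r : M.Node) : Matrix (M.FlatNode r) (M.FlatNode r) ℝ :=
  Matrix.of fun j k => M.energy (M.nodeFun k) (M.nodeFun j)

def stiffFlatMod (r : M.Node) (s : M.FlatNode r) : Matrix (M.FlatNode r) (M.FlatNode r) ℝ :=
  Matrix.of fun j k => if j = s then 1 else M.energy (M.nodeFun k) (M.nodeFun j)

def stiffA : Matrix (Fin 2) (Fin 2) ℝ :=
  Matrix.of fun j k => M.energy (M.psi k) (M.psi j)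

/-- Linear combinations of `𝔅`, `𝔅♭`, `𝔈 = 𝔅 ∪ 𝔄` and `𝔈♭ = 𝔅♭ ∪ 𝔄`. -/
def combB (c : M.Node → ℝ) : M.Broken := ∑ z, c z • M.nodeFun z
def combBFlat (r : M.Node) (c : M.FlatNode r → ℝ) : M.Broken := ∑ z, c z • M.nodeFun z
def combE (c : M.Node ⊕ Fin 2 → ℝ) : M.Broken :=
  M.combB (c ∘ Sum.inl) + ∑ k, c (Sum.inr k) • M.psi k
def combEFlat (r : M.Node) (c : M.FlatNode r ⊕ Fin 2 → ℝ) : M.Broken :=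
  M.combBFlat r (c ∘ Sum.inl) + ∑ k, c (Sum.inr k) • M.psi k

/-- The block-diagonal system matrices. -/
def sysFlatMod (r : M.Node) (s : M.FlatNode r) :
    Matrix (M.FlatNode r ⊕ Fin 2) (M.FlatNode r ⊕ Fin 2) ℝ :=
  Matrix.fromBlocks (M.stiffFlatMod r s) 0 0 M.stiffA
def sysFlat (r : M.Node) : Matrix (M.FlatNode r ⊕ Fin 2) (M.FlatNode r ⊕ Fin 2) ℝ :=
  Matrix.fromBlocks (M.stiffFlat r) 0 0 M.stiffA
def sysE : Matrix (M.Node ⊕ Fin 2) (M.Node ⊕ Fin 2) ℝ :=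
  Matrix.fromBlocks M.stiffB 0 0 M.stiffA

/-- The load vectors. -/
def loadB (f : ℝ × ℝ → ℝ) : M.Node → ℝ := fun z => M.load f (M.nodeFun z)
def loadA (f : ℝ × ℝ → ℝ) : Fin 2 → ℝ := fun k => M.load f (M.psi k)
def loadFlatMod (f : ℝ × ℝ → ℝ) (r : M.Node) (s : M.FlatNode r) : M.FlatNode r ⊕ Fin 2 → ℝ :=
  Sum.elim (fun z => if z = s then 0 else M.load f (M.nodeFun z)) (M.loadA f)
def loadFlat (f : ℝ × ℝ → ℝ) (r : M.Node) : M.FlatNode r ⊕ Fin 2 → ℝ :=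
  Sum.elim (fun z => M.load f (M.nodeFun z)) (M.loadA f)
def loadE (f : ℝ × ℝ → ℝ) : M.Node ⊕ Fin 2 → ℝ := Sum.elim (M.loadB f) (M.loadA f)

/-- `x` is a Krylov solution of `A x = b` for the initial guess `x₀`: it solves the system, and
`x - x₀` lies in the Krylov space of `A` generated by the initial residual. -/
def IsKrylovSolution {ι : Type*} [Fintype ι] [DecidableEq ι] (A : Matrix ι ι ℝ) (b x₀ x : ι → ℝ) :
    Prop :=
  A *ᵥ x = b ∧
    x - x₀ ∈ Submodule.span ℝ (Set.range fun k : ℕ => (A ^ k) *ᵥ (b - A *ᵥ x₀))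

/-- Option 1: the nonsymmetric modified system. -/
def IsOption1 (f : ℝ × ℝ → ℝ) (r : M.Node) (s : M.FlatNode r) (u : M.Broken) : Prop :=
  ∃ c, M.sysFlatMod r s *ᵥ c = M.loadFlatMod f r s ∧ u = M.combEFlat r c

/-- Option 2: the unmodified symmetric system on `𝔈♭` with the zero-mean condition. -/
def IsOption2 (f : ℝ × ℝ → ℝ) (r : M.Node) (u : M.Broken) : Prop :=
  ∃ c, M.sysFlat r *ᵥ c = M.loadFlat f r ∧ ∑ z, c (Sum.inl z) = 0 ∧ u = M.combEFlat r c

/-- Option 2 as an algorithm: a Krylov solution `c'` from some initial guess is post-processed with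
the coefficient vector `w` of the constant function `1`, so as to enforce the zero-mean condition. -/
def IsOption2Scheme (f : ℝ × ℝ → ℝ) (r : M.Node) (u : M.Broken) : Prop :=
  ∃ (c₀ c' : M.FlatNode r ⊕ Fin 2 → ℝ) (w : M.FlatNode r → ℝ),
    IsKrylovSolution (M.sysFlat r) (M.loadFlat f r) c₀ c' ∧
    M.combBFlat r w = (fun _ => (1, 0, 0)) ∧
    u = M.combEFlat r
      (c' - ((∑ z, c' (Sum.inl z)) / ∑ z, w z) • (Sum.elim w 0 : M.FlatNode r ⊕ Fin 2 → ℝ))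

/-- Option 3: the symmetric system on `𝔈` with the zero-mean condition. -/
def IsOption3 (f : ℝ × ℝ → ℝ) (u : M.Broken) : Prop :=
  ∃ c, M.sysE *ᵥ c = M.loadE f ∧ ∑ z, c (Sum.inl z) = 0 ∧ u = M.combE c

/-- Option 3 as an algorithm: a Krylov solution from an initial guess with zero mean. -/
def IsOption3Scheme (f : ℝ × ℝ → ℝ) (u : M.Broken) : Prop :=
  ∃ c₀ c, ∑ z, c₀ (Sum.inl z) = 0 ∧ IsKrylovSolution M.sysE (M.loadE f) c₀ c ∧ u = M.combE c

/-- Option 4: a Krylov solution of the system on `𝔅` from an initial guess with zero mean. -/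
def IsOption4 (f : ℝ × ℝ → ℝ) (u : M.Broken) : Prop :=
  ∃ c₀ c, ∑ z, c₀ z = 0 ∧ IsKrylovSolution M.stiffB (M.loadB f) c₀ c ∧ u = M.combB c

end RectMesh

end

/-! The midpoint values of a combination of `𝔅` are means of neighbouring nodal coefficients
(`combB_eq`). If its gradient vanishes on every element, the coefficients agree along both diagonals
of every cell, so they depend on the checkerboard colour only (`eq_of_color_eq`). Conversely, each
colour indicator represents the constant `1 / 2` (`combB_color`). The kernel of `stiffB` is
therefore spanned by the two indicators, and a kernel vector represents the constant equal to its
mean coefficient (`combB_eq_const`). Hence a solution of the `𝔅`-system is determined, as a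
function, by the sum of its coefficients.

By symmetry, every vector in the range of `stiffB` sums to zero over each colour. So does the load,
because `∫ f = 0`. One equation per colour is then redundant (`stiffB_mulVec_eq_of_forall_ne`).
Since `r` and `s` have opposite colours, dropping the row of `r` and overwriting that of `s` loses
nothing. The modified matrix is injective, which gives existence for option 1. Its solution also
solves options 2 and 3, and uniqueness for option 3 identifies all three.

For a consistent symmetric system the Krylov correction lies in the range, hence is orthogonal to
the kernel. The Krylov solution thus exists, and the coefficient sum of the initial guess is
preserved.

Options 3 and 4 differ by the part in `ψ_x, ψ_y`. Here the matrix is diagonal with entries `4|Ω| /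
width²` (`stiffA_eq`) and the loads are at most `|Ω|^(1/2) ‖f‖`, so the coefficients are of second
order in the mesh widths. -/

noncomputable section

namespace RectMesh

/-! ### Krylov solutions of consistent symmetric systems -/

section Krylov

variable {ι : Type*} [Fintype ι] {A : Matrix ι ι ℝ}

/-- The kernel of a symmetric matrix meets its range trivially. -/
lemma mulVec_eq_zero_of_mulVec_mulVec_eq_zero (hA : A.IsSymm) {v : ι → ℝ}
    (h : A *ᵥ (A *ᵥ v) = 0) : A *ᵥ v = 0 := by
  have : A *ᵥ v ⬝ᵥ A *ᵥ v = 0 := by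
    rw [Matrix.dotProduct_mulVec, ← Matrix.mulVec_transpose, hA.eq, h, zero_dotProduct]
  exact dotProduct_self_eq_zero.1 this

lemma dotProduct_mulVec_eq_zero (hA : A.IsSymm) {k : ι → ℝ} (hk : A *ᵥ k = 0) (v : ι → ℝ) :
    k ⬝ᵥ A *ᵥ v = 0 := by
  rw [Matrix.dotProduct_mulVec, ← Matrix.mulVec_transpose, hA.eq, hk, zero_dotProduct]

variable [DecidableEq ι]

/-- The Krylov space of a residual in the range of `A` is contained in the range. -/
lemma krylov_le_range (r y : ι → ℝ) (hr : A *ᵥ y = r) :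
    Submodule.span ℝ (Set.range fun k : ℕ => (A ^ k) *ᵥ r) ≤ LinearMap.range A.mulVecLin := by
  rw [Submodule.span_le]
  rintro _ ⟨k, rfl⟩
  refine ⟨(A ^ k) *ᵥ y, ?_⟩
  simp only [Matrix.mulVecLin_apply, ← hr, Matrix.mulVec_mulVec]
  rw [← pow_succ, ← pow_succ']

/-- Consistent symmetric systems have Krylov solutions from every initial guess. -/
lemma exists_isKrylovSolution (hA : A.IsSymm) {b y : ι → ℝ} (hy : A *ᵥ y = b) (x₀ : ι → ℝ) :
    ∃ x, IsKrylovSolution A b x₀ x := by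
  set r := b - A *ᵥ x₀ with hr
  have hr' : A *ᵥ (y - x₀) = r := by rw [Matrix.mulVec_sub, hy]
  set W := Submodule.span ℝ (Set.range fun k : ℕ => (A ^ k) *ᵥ r) with hW
  have hle := krylov_le_range r _ hr'
  have hinv : ∀ w ∈ W, A.mulVecLin w ∈ W := by
    intro w hw
    have : W.map A.mulVecLin ≤ W := by
      rw [hW, Submodule.map_span, Submodule.span_le]
      rintro _ ⟨_, ⟨k, rfl⟩, rfl⟩
      refine Submodule.subset_span ⟨k + 1, ?_⟩
      simp [Matrix.mulVec_mulVec, pow_succ']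
    exact this ⟨w, hw, rfl⟩
  -- The Krylov space lies in the range of `A`, which meets the kernel trivially. Thus `A` is
  -- injective on this invariant space, hence surjective by finite dimension, and the residual has a
  -- preimage inside it.
  have hinj : Function.Injective (A.mulVecLin.restrict hinv) := by
    rw [injective_iff_map_eq_zero]
    rintro ⟨w, hw⟩ h0
    obtain ⟨v, rfl⟩ := hle hw
    have h0' : A *ᵥ (A *ᵥ v) = 0 := congrArg Subtype.val h0
    exact Subtype.ext (mulVec_eq_zero_of_mulVec_mulVec_eq_zero hA h0')
  obtain ⟨⟨d, hd⟩, hAd⟩ := LinearMap.injective_iff_surjective.1 hinj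
    ⟨r, Submodule.subset_span ⟨0, by simp⟩⟩
  have hAd' : A *ᵥ d = r := congrArg Subtype.val hAd
  refine ⟨x₀ + d, ?_, ?_⟩
  · rw [Matrix.mulVec_add, hAd', hr]; abel
  · simpa using hd

/-- The correction of a Krylov solution of a symmetric system is orthogonal to the kernel. -/
lemma IsKrylovSolution.dotProduct_eq (hA : A.IsSymm) {b x₀ x : ι → ℝ}
    (h : IsKrylovSolution A b x₀ x) {k : ι → ℝ} (hk : A *ᵥ k = 0) : k ⬝ᵥ x = k ⬝ᵥ x₀ := by
  obtain ⟨v, hv⟩ := krylov_le_range (A := A) _ (x - x₀)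
    (by rw [Matrix.mulVec_sub, h.1]) h.2
  have := dotProduct_mulVec_eq_zero hA hk v
  rw [Matrix.mulVecLin_apply] at hv
  rw [hv, dotProduct_sub] at this
  linarith

end Krylov

variable {ℓ₁ ℓ₂ : ℝ} (M : RectMesh ℓ₁ ℓ₂)

/-! ### Basic facts on the mesh and the energy form -/

lemma hx_pos (h1 : 0 < ℓ₁) : 0 < M.hx := div_pos h1 (Nat.cast_pos.2 M.Nx_pos)
lemma hy_pos (h2 : 0 < ℓ₂) : 0 < M.hy := div_pos h2 (Nat.cast_pos.2 M.Ny_pos)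

lemma Nx_mul_hx : M.Nx * M.hx = ℓ₁ :=
  mul_div_cancel₀ _ (Nat.cast_ne_zero.2 M.Nx_pos.ne')
lemma Ny_mul_hy : M.Ny * M.hy = ℓ₂ :=
  mul_div_cancel₀ _ (Nat.cast_ne_zero.2 M.Ny_pos.ne')

lemma hx_sq_add_hy_sq_le {h : ℝ} (hh : M.diam ≤ h) : 0 ≤ h ∧ M.hx ^ 2 + M.hy ^ 2 ≤ h ^ 2 := by
  have h0 : 0 ≤ h := (Real.sqrt_nonneg _).trans hh
  exact ⟨h0, (Real.sqrt_le_left h0).1 hh⟩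

lemma volume_real_cellSet (h1 : 0 < ℓ₁) (h2 : 0 < ℓ₂) (K : M.Cell) :
    volume.real (M.cellSet K) = M.hx * M.hy := by
  have hx := M.hx_pos h1
  have hy := M.hy_pos h2
  rw [cellSet, Measure.volume_eq_prod, measureReal_def, Measure.prod_prod, ENNReal.toReal_mul,
    Real.volume_Ioo, Real.volume_Ioo, ENNReal.toReal_ofReal (by linarith),
    ENNReal.toReal_ofReal (by linarith)]
  ring

lemma energy_eq (h1 : 0 < ℓ₁) (h2 : 0 < ℓ₂) (u v : M.Broken) :
    M.energy u v =
      M.hx * M.hy * ∑ K, ((u K).2.1 * (v K).2.1 + (u K).2.2 * (v K).2.2) := by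
  rw [energy, Finset.mul_sum]
  refine Finset.sum_congr rfl fun K _ => ?_
  rw [setIntegral_const, M.volume_real_cellSet h1 h2, smul_eq_mul]

lemma energy_comm (u v : M.Broken) : M.energy u v = M.energy v u := by
  simp only [energy, mul_comm]

lemma energy_sum_smul (h1 : 0 < ℓ₁) (h2 : 0 < ℓ₂) {ι : Type*} [Fintype ι] (c : ι → ℝ)
    (u : ι → M.Broken) (v : M.Broken) :
    M.energy (∑ k, c k • u k) v = ∑ k, c k * M.energy (u k) v := by
  simp only [M.energy_eq h1 h2, Finset.sum_apply, Prod.snd_sum, Prod.fst_sum, Pi.smul_apply,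
    Prod.smul_snd, Prod.smul_fst, smul_eq_mul, Finset.sum_mul, Finset.mul_sum,
    ← Finset.sum_add_distrib]
  rw [Finset.sum_comm]
  refine Finset.sum_congr rfl fun k _ => Finset.sum_congr rfl fun K _ => ?_
  ring

lemma energy_const_left (a : ℝ) (v : M.Broken) : M.energy (fun _ => (a, 0, 0)) v = 0 := by
  simp [energy]

lemma slopes_eq_zero_of_energy_eq_zero (h1 : 0 < ℓ₁) (h2 : 0 < ℓ₂) {v : M.Broken}
    (h : M.energy v v = 0) (K : M.Cell) : (v K).2 = 0 := by
  have hx := M.hx_pos h1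
  have hy := M.hy_pos h2
  rw [M.energy_eq h1 h2, mul_eq_zero, or_iff_right (by positivity),
    Finset.sum_eq_zero_iff_of_nonneg fun K _ => by nlinarith [sq_nonneg (v K).2.1, sq_nonneg (v K).2.2]] at h
  have := h K (Finset.mem_univ _)
  ext
  · simp only [Prod.fst_zero]; nlinarith [sq_nonneg (v K).2.1, sq_nonneg (v K).2.2]
  · simp only [Prod.snd_zero]; nlinarith [sq_nonneg (v K).2.1, sq_nonneg (v K).2.2]

/-! ### Combinations of the node-based functions -/

lemma ofMidpoints_sum_smul {ι : Type*} [Fintype ι] (c : ι → ℝ)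
    (vert horiz : ι → Fin M.Nx → Fin M.Ny → ℝ) :
    ∑ k, c k • M.ofMidpoints (vert k) (horiz k) =
      M.ofMidpoints (fun i j => ∑ k, c k * vert k i j) (fun i j => ∑ k, c k * horiz k i j) := by
  funext K
  rw [Finset.sum_apply]
  ext
  · simp only [Prod.fst_sum, Pi.smul_apply, Prod.smul_fst, ofMidpoints, smul_eq_mul,
      ← Finset.sum_sub_distrib, ← Finset.sum_add_distrib, Finset.sum_div, Finset.sum_mul]
    exact Finset.sum_congr rfl fun k _ => by ring
  · simp only [Prod.fst_sum, Prod.snd_sum, Pi.smul_apply, Prod.smul_fst, Prod.smul_snd,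
      ofMidpoints, smul_eq_mul, ← Finset.sum_sub_distrib, Finset.sum_div]
    exact Finset.sum_congr rfl fun k _ => by ring
  · simp only [Prod.snd_sum, Pi.smul_apply, Prod.smul_snd,
      ofMidpoints, smul_eq_mul, ← Finset.sum_sub_distrib, Finset.sum_div]
    exact Finset.sum_congr rfl fun k _ => by ring

/-- If `p = q`, the sum would be only `c p / 2`. Evenness of the subdivision numbers rules out an
edge whose two ends are identified. -/
lemma sum_mul_ite_or {ι : Type*} [Fintype ι] [DecidableEq ι] (c : ι → ℝ) {p q : ι}
    (hpq : p ≠ q) : ∑ z, c z * (if z = p ∨ z = q then 1 / 2 else 0) = (c p + c q) / 2 := by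
  have : ∀ z, c z * (if z = p ∨ z = q then 1 / 2 else 0) =
      (if z = p then c p / 2 else 0) + (if z = q then c q / 2 else 0) := by
    intro z
    by_cases h : z = p
    · subst h; simp [hpq]; ring
    · by_cases h' : z = q
      · subst h'; simp [h]; ring
      · simp [h, h']
  simp only [this, Finset.sum_add_distrib, Finset.sum_ite_eq', Finset.mem_univ, if_true]
  ring

/-- The midpoint values of a combination of `𝔅` are the means of the two nodal coefficients. -/
lemma combB_eq (hNx : Even M.Nx) (hNy : Even M.Ny) (c : M.Node → ℝ) :
    M.combB c = M.ofMidpoints (fun i j => (c (i, j) + c (i, j + 1)) / 2)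
      (fun i j => (c (i, j) + c (i + 1, j)) / 2) := by
  simp only [combB, nodeFun]
  rw [M.ofMidpoints_sum_smul]
  congr 1
  · funext i j
    refine sum_mul_ite_or c fun h => fin_add_one_ne hNy j (congrArg Prod.snd h).symm
  · funext i j
    refine sum_mul_ite_or c fun h => fin_add_one_ne hNx i (congrArg Prod.fst h).symm

lemma combB_sub (c d : M.Node → ℝ) : M.combB (c - d) = M.combB c - M.combB d := by
  simp [combB, sub_smul]

lemma ofMidpoints_const (a : ℝ) :
    M.ofMidpoints (fun _ _ => a) (fun _ _ => a) = fun _ => (a, 0, 0) := by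
  funext K
  simp [ofMidpoints]
  ring

lemma val_add_one_mod_two {n : ℕ} [NeZero n] (hn : Even n) (i : Fin n) :
    ((i + 1 : Fin n) : ℕ) % 2 = ((i : ℕ) + 1) % 2 := by
  rw [Fin.val_add, Fin.val_one', Nat.add_mod_mod]
  exact Nat.mod_mod_of_dvd _ hn.two_dvd

lemma color_right (hNx : Even M.Nx) (i j) : M.color (i + 1, j) = 1 - M.color (i, j) := by
  have := val_add_one_mod_two hNx i
  simp only [color]
  omega

lemma color_up (hNy : Even M.Ny) (i j) : M.color (i, j + 1) = 1 - M.color (i, j) := by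
  have := val_add_one_mod_two hNy j
  simp only [color]
  omega

lemma color_lt_two (z : M.Node) : M.color z < 2 := Nat.mod_lt _ two_pos

/-- The combination of the functions of one colour is the constant `1 / 2`. -/
lemma combB_color (hNx : Even M.Nx) (hNy : Even M.Ny) (a : M.Node) :
    M.combB (fun z => if M.color z = M.color a then 1 else 0) = fun _ => (1 / 2, 0, 0) := by
  rw [M.combB_eq hNx hNy, ← M.ofMidpoints_const]
  have ha := M.color_lt_two a
  congr 1 <;> funext i j <;> have := M.color_lt_two (i, j)
  · rw [M.color_up hNy]
    split_ifs <;> first | omega | norm_num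
  · rw [M.color_right hNx]
    split_ifs <;> first | omega | norm_num

lemma combB_one (hNx : Even M.Nx) (hNy : Even M.Ny) :
    M.combB (fun _ => 1) = fun _ => (1, 0, 0) := by
  rw [M.combB_eq hNx hNy, ← M.ofMidpoints_const]
  norm_num

/-- A combination of `𝔅` with vanishing slopes has coefficients depending on the colour only. -/
lemma eq_of_color_eq (h1 : 0 < ℓ₁) (h2 : 0 < ℓ₂) (hNx : Even M.Nx) (hNy : Even M.Ny)
    {c : M.Node → ℝ} (hc : ∀ K, (M.combB c K).2 = 0) {z w : M.Node}
    (hzw : M.color z = M.color w) : c z = c w := by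
  have hx := (M.hx_pos h1).ne'
  have hy := (M.hy_pos h2).ne'
  rw [M.combB_eq hNx hNy] at hc
  -- The two vanishing slopes are linear relations among the four corner coefficients. Their sum and
  -- their difference give the equalities along the two diagonals.
  have key : ∀ i j, c (i + 1, j + 1) = c (i, j) ∧ c (i, j + 1) = c (i + 1, j) := by
    intro i j
    have h := hc (i, j)
    simp only [ofMidpoints, Prod.mk_eq_zero, div_eq_zero_iff, hx, hy, or_false] at h
    constructor <;> linarith [h.1, h.2]
  -- Unrolling the torus to `ℕ × ℕ` avoids wrap-around. There the diagonal relations make the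
  -- coefficient a function of `m + n` of period two, so of the colour.
  let g : ℕ → ℕ → ℝ := fun m n => c (Fin.ofNat M.Nx m, Fin.ofNat M.Ny n)
  have succ_cast : ∀ (n m : ℕ) [NeZero n], Fin.ofNat n (m + 1) = Fin.ofNat n m + 1 := by
    intro n m _
    ext
    simp [Fin.val_add, Fin.ofNat]
  have gd : ∀ m n, g (m + 1) (n + 1) = g m n := fun m n => by
    simp only [g, succ_cast]; exact (key _ _).1
  have ga : ∀ m n, g m (n + 1) = g (m + 1) n := fun m n => by
    simp only [g, succ_cast]; exact (key _ _).2
  have g0 : ∀ n m, g m n = g (m + n) 0 := by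
    intro n
    induction n with
    | zero => intro m; rfl
    | succ n ih => intro m; rw [ga, ih]; congr 1; omega
  have gp : ∀ m, g (m + 2) 0 = g m 0 := fun m => by rw [← ga (m + 1) 0, gd]
  have gm : ∀ k m, g (m + 2 * k) 0 = g m 0 := by
    intro k
    induction k with
    | zero => intro m; rfl
    | succ k ih => intro m; rw [← ih m, ← gp (m + 2 * k)]; congr 1
  have main : ∀ z : M.Node, c z = g (M.color z) 0 := by
    rintro ⟨i, j⟩
    have e : g i j = c (i, j) := by simp [g]
    rw [← e, g0, color, ← gm (((i : ℕ) + (j : ℕ)) / 2) (((i : ℕ) + (j : ℕ)) % 2),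
      Nat.mod_add_div]
  rw [main z, main w, hzw]

/-- Coefficients of nodes of different colours sum up to twice the mean. -/
lemma add_eq_of_color_ne (h1 : 0 < ℓ₁) (h2 : 0 < ℓ₂) (hNx : Even M.Nx) (hNy : Even M.Ny)
    {c : M.Node → ℝ} (hc : ∀ K, (M.combB c K).2 = 0) {z w : M.Node}
    (hzw : M.color z ≠ M.color w) : c z + c w = 2 * ((∑ z, c z) / (M.Nx * M.Ny)) := by
  have hN : (M.Nx * M.Ny : ℝ) ≠ 0 :=
    mul_ne_zero (Nat.cast_ne_zero.2 M.Nx_pos.ne') (Nat.cast_ne_zero.2 M.Ny_pos.ne')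
  have hcol : ∀ {p q : M.Node}, M.color p = M.color q → c p = c q := fun h =>
    M.eq_of_color_eq h1 h2 hNx hNy hc h
  -- A horizontal shift by one exchanges the colours and permutes the nodes. Summing this identity
  -- over all nodes counts every coefficient twice.
  have hsw : ∀ z' : M.Node, c z' + c (z'.1 + 1, z'.2) = c z + c w := by
    intro z'
    have e := M.color_right hNx z'.1 z'.2
    have a1 := M.color_lt_two z
    have a2 := M.color_lt_two w
    have a3 := M.color_lt_two z'
    rcases eq_or_ne (M.color z') (M.color z) with h | h
    · rw [hcol h, hcol (p := (z'.1 + 1, z'.2)) (q := w) (by rw [e, Prod.mk.eta]; omega)]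
    · rw [hcol (p := z') (q := w) (by omega),
        hcol (p := (z'.1 + 1, z'.2)) (q := z) (by rw [e, Prod.mk.eta]; omega), add_comm]
  have hsum : ∑ z' : M.Node, c (z'.1 + 1, z'.2) = ∑ z', c z' :=
    Equiv.sum_comp ((Equiv.addRight (1 : Fin M.Nx)).prodCongr (Equiv.refl (Fin M.Ny))) c
  have := Finset.sum_congr (s₁ := Finset.univ) rfl fun z' _ => hsw z'
  rw [Finset.sum_add_distrib, hsum, Finset.sum_const, Finset.card_univ, Fintype.card_prod,
    Fintype.card_fin, Fintype.card_fin, nsmul_eq_mul] at this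
  push_cast at this
  rw [← mul_div_assoc, eq_div_iff hN]
  linarith

/-- The ends of an edge have opposite colours, so every midpoint value is the mean of all
coefficients. -/
lemma combB_eq_const (h1 : 0 < ℓ₁) (h2 : 0 < ℓ₂) (hNx : Even M.Nx) (hNy : Even M.Ny)
    {c : M.Node → ℝ} (hc : ∀ K, (M.combB c K).2 = 0) :
    M.combB c = fun _ => ((∑ z, c z) / (M.Nx * M.Ny), 0, 0) := by
  rw [M.combB_eq hNx hNy, ← M.ofMidpoints_const]
  congr 1 <;> funext i j
  · rw [M.add_eq_of_color_ne h1 h2 hNx hNy hc]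
    · ring
    · rw [M.color_up hNy]; omega
  · rw [M.add_eq_of_color_ne h1 h2 hNx hNy hc]
    · ring
    · rw [M.color_right hNx]; omega

/-! ### The stiffness matrix of the node-based functions -/

lemma stiffB_isSymm : M.stiffB.IsSymm := by
  ext j k
  exact M.energy_comm _ _

lemma stiffB_mulVec (h1 : 0 < ℓ₁) (h2 : 0 < ℓ₂) (c : M.Node → ℝ) (j : M.Node) :
    (M.stiffB *ᵥ c) j = M.energy (M.combB c) (M.nodeFun j) := by
  rw [combB, M.energy_sum_smul h1 h2]
  simp [Matrix.mulVec, dotProduct, stiffB, mul_comm]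

lemma stiffB_mulVec_of_const (h1 : 0 < ℓ₁) (h2 : 0 < ℓ₂) {c : M.Node → ℝ} {a : ℝ}
    (hc : M.combB c = fun _ => (a, 0, 0)) : M.stiffB *ᵥ c = 0 := by
  funext j
  rw [M.stiffB_mulVec h1 h2, hc, energy_const_left, Pi.zero_apply]

/-- Pairing `stiffB *ᵥ c` with `c` gives the energy of the combination. -/
lemma slopes_eq_zero_of_stiffB_mulVec (h1 : 0 < ℓ₁) (h2 : 0 < ℓ₂) {c : M.Node → ℝ}
    (hc : M.stiffB *ᵥ c = 0) (K : M.Cell) : (M.combB c K).2 = 0 := by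
  refine M.slopes_eq_zero_of_energy_eq_zero h1 h2 ?_ K
  rw [energy_comm]
  nth_rw 1 [combB]
  rw [M.energy_sum_smul h1 h2]
  refine Finset.sum_eq_zero fun z _ => ?_
  rw [energy_comm, ← M.stiffB_mulVec h1 h2, hc, Pi.zero_apply, mul_zero]

/-- Solutions of the `𝔅`-system with prescribed sum represent the same function. -/
lemma combB_eq_of_stiffB_mulVec_eq (h1 : 0 < ℓ₁) (h2 : 0 < ℓ₂) (hNx : Even M.Nx)
    (hNy : Even M.Ny) {c d : M.Node → ℝ} (h : M.stiffB *ᵥ c = M.stiffB *ᵥ d)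
    (hs : ∑ z, c z = ∑ z, d z) : M.combB c = M.combB d := by
  have h0 : M.stiffB *ᵥ (c - d) = 0 := by rw [Matrix.mulVec_sub, h, sub_self]
  have := M.combB_eq_const h1 h2 hNx hNy (M.slopes_eq_zero_of_stiffB_mulVec h1 h2 h0)
  rw [M.combB_sub] at this
  rw [← sub_eq_zero, this]
  simp only [Pi.sub_apply, Finset.sum_sub_distrib, hs, sub_self, zero_div]
  rfl

/-- The colour indicator lies in the kernel, and the kernel of a symmetric matrix is orthogonal to
its range. -/
lemma sum_color_stiffB_mulVec (h1 : 0 < ℓ₁) (h2 : 0 < ℓ₂) (hNx : Even M.Nx) (hNy : Even M.Ny)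
    (c : M.Node → ℝ) (a : M.Node) :
    ∑ z, (if M.color z = M.color a then 1 else 0) * (M.stiffB *ᵥ c) z = 0 :=
  dotProduct_mulVec_eq_zero M.stiffB_isSymm
    (M.stiffB_mulVec_of_const h1 h2 (M.combB_color hNx hNy a)) c

lemma sum_stiffB_krylov (h1 : 0 < ℓ₁) (h2 : 0 < ℓ₂) (hNx : Even M.Nx) (hNy : Even M.Ny)
    {b c₀ c : M.Node → ℝ} (h : IsKrylovSolution M.stiffB b c₀ c) :
    ∑ z, c z = ∑ z, c₀ z := by
  have := h.dotProduct_eq M.stiffB_isSymm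
    (M.stiffB_mulVec_of_const h1 h2 (M.combB_one hNx hNy))
  simpa [dotProduct] using this

/-! ### Piecewise linear functions as functions on the domain -/

lemma eq_of_mem_Ioo_mul {n : ℕ} {i k : Fin n} {h x : ℝ} (hh : 0 < h)
    (hi : x ∈ Set.Ioo ((i : ℕ) * h) (((i : ℕ) + 1) * h))
    (hk : x ∈ Set.Ioo ((k : ℕ) * h) (((k : ℕ) + 1) * h)) : i = k := by
  have a := lt_of_mul_lt_mul_right (hi.1.trans hk.2) hh.le
  have b := lt_of_mul_lt_mul_right (hk.1.trans hi.2) hh.le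
  norm_cast at a b
  ext
  omega

/-- The index is `⌊x / h⌋₊`. Staying off the grid points makes its lower bound strict. -/
lemma exists_mem_Ioo_mul {n : ℕ} {h x : ℝ} (hh : 0 < h) (hx : x ∈ Set.Ioo 0 (n * h))
    (hne : ∀ k : ℕ, (k : ℝ) * h ≠ x) :
    ∃ i : Fin n, x ∈ Set.Ioo ((i : ℕ) * h) (((i : ℕ) + 1) * h) := by
  have hq : 0 ≤ x / h := (div_pos hx.1 hh).le
  have hlt : ⌊x / h⌋₊ < n := (Nat.floor_lt hq).2 ((div_lt_iff₀ hh).2 hx.2)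
  refine ⟨⟨_, hlt⟩, lt_of_le_of_ne ?_ (hne _), ?_⟩
  · exact (le_div_iff₀ hh).1 (Nat.floor_le hq)
  · exact (div_lt_iff₀ hh).1 (Nat.lt_floor_add_one _)

lemma eq_of_mem_cellSet (h1 : 0 < ℓ₁) (h2 : 0 < ℓ₂) {K L : M.Cell} {z : ℝ × ℝ}
    (hK : z ∈ M.cellSet K) (hL : z ∈ M.cellSet L) : K = L :=
  Prod.ext (eq_of_mem_Ioo_mul (M.hx_pos h1) hK.1 hL.1)
    (eq_of_mem_Ioo_mul (M.hy_pos h2) hK.2 hL.2)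

lemma toFun_of_mem (h1 : 0 < ℓ₁) (h2 : 0 < ℓ₂) (v : M.Broken) {K : M.Cell} {z : ℝ × ℝ}
    (hz : z ∈ M.cellSet K) : M.toFun v z = evalP1 (v K) z := by
  rw [toFun, Finset.sum_eq_single K, Set.indicator_of_mem hz]
  · intro L _ hL
    exact Set.indicator_of_notMem (fun h => hL (M.eq_of_mem_cellSet h1 h2 h hz)) _
  · simp

lemma measurableSet_dom : MeasurableSet M.dom := measurableSet_Ioo.prod measurableSet_Ioo

/-- The elements cover the domain up to a null set. -/
lemma ae_exists_mem_cellSet (h1 : 0 < ℓ₁) (h2 : 0 < ℓ₂) :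
    ∀ᵐ z ∂(volume.restrict M.dom), ∃ K, z ∈ M.cellSet K := by
  have hne : ∀ h : ℝ, ∀ᵐ x : ℝ, ∀ k : ℕ, (k : ℝ) * h ≠ x := fun h => by
    rw [ae_all_iff]
    exact fun k => by simpa [eq_comm] using Measure.ae_ne volume ((k : ℝ) * h)
  have hfst : ∀ᵐ z : ℝ × ℝ, ∀ k : ℕ, (k : ℝ) * M.hx ≠ z.1 :=
    Measure.quasiMeasurePreserving_fst.ae (hne M.hx)
  have hsnd : ∀ᵐ z : ℝ × ℝ, ∀ k : ℕ, (k : ℝ) * M.hy ≠ z.2 :=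
    Measure.quasiMeasurePreserving_snd.ae (hne M.hy)
  rw [ae_restrict_iff' M.measurableSet_dom]
  filter_upwards [hfst, hsnd] with z hz1 hz2 hz
  obtain ⟨i, hi⟩ := exists_mem_Ioo_mul (n := M.Nx) (M.hx_pos h1)
    (by rw [Nx_mul_hx]; exact hz.1) hz1
  obtain ⟨j, hj⟩ := exists_mem_Ioo_mul (n := M.Ny) (M.hy_pos h2)
    (by rw [Ny_mul_hy]; exact hz.2) hz2
  exact ⟨(i, j), hi, hj⟩

lemma toFun_sum_smul {ι : Type*} [Fintype ι] (c : ι → ℝ) (u : ι → M.Broken) (z : ℝ × ℝ) :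
    M.toFun (∑ k, c k • u k) z = ∑ k, c k * M.toFun (u k) z := by
  simp only [toFun, Finset.mul_sum]
  rw [Finset.sum_comm]
  refine Finset.sum_congr rfl fun K _ => ?_
  by_cases hz : z ∈ M.cellSet K
  · simp only [Set.indicator_of_mem hz, evalP1, Finset.sum_apply, Prod.fst_sum, Prod.snd_sum,
      Pi.smul_apply, Prod.smul_fst, Prod.smul_snd, smul_eq_mul, Finset.sum_mul,
      ← Finset.sum_add_distrib]
    exact Finset.sum_congr rfl fun k _ => by ring
  · simp [Set.indicator_of_notMem hz]

lemma measurable_toFun (v : M.Broken) : Measurable (M.toFun v) := by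
  refine Finset.measurable_fun_sum _ fun K _ => Measurable.indicator ?_
    (measurableSet_Ioo.prod measurableSet_Ioo)
  unfold evalP1
  fun_prop

/-- A crude bound: only its finiteness matters, for the integrability of `f z * M.toFun v z`. -/
lemma norm_toFun_le (v : M.Broken) {z : ℝ × ℝ} (hz : z ∈ M.dom) :
    ‖M.toFun v z‖ ≤ ∑ K, (|(v K).1| + |(v K).2.1| * ℓ₁ + |(v K).2.2| * ℓ₂) := by
  have hz1 : |z.1| ≤ ℓ₁ := by rw [abs_of_pos hz.1.1]; exact hz.1.2.le
  have hz2 : |z.2| ≤ ℓ₂ := by rw [abs_of_pos hz.2.1]; exact hz.2.2.le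
  refine (norm_sum_le _ _).trans (Finset.sum_le_sum fun K _ => ?_)
  refine (Set.indicator_le_self' (f := fun z => ‖evalP1 (v K) z‖)
    (fun _ _ => norm_nonneg _) z |>.trans' (norm_indicator_eq_indicator_norm _ _).le).trans ?_
  simp only [evalP1, Real.norm_eq_abs]
  refine (abs_add_le _ _).trans (add_le_add ((abs_add_le _ _).trans (add_le_add le_rfl ?_)) ?_)
  · rw [abs_mul]; gcongr
  · rw [abs_mul]; gcongr

instance : IsFiniteMeasure (volume.restrict M.dom) := by
  refine ⟨?_⟩
  rw [Measure.restrict_apply_univ, dom, Measure.volume_eq_prod, Measure.prod_prod]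
  simp [ENNReal.mul_lt_top]

lemma volume_dom (h1 : 0 < ℓ₁) : volume M.dom = ENNReal.ofReal (ℓ₁ * ℓ₂) := by
  rw [dom, Measure.volume_eq_prod, Measure.prod_prod, Real.volume_Ioo, Real.volume_Ioo,
    ENNReal.ofReal_mul h1.le, sub_zero, sub_zero]

/-! ### The load functional -/

section Load

variable {M} {f : ℝ × ℝ → ℝ}

lemma integrable_mul_toFun (hf : MemLp f 2 (volume.restrict M.dom)) (v : M.Broken) :
    Integrable (fun z => f z * M.toFun v z) (volume.restrict M.dom) := by
  simp only [mul_comm (f _)]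
  refine (hf.integrable one_le_two).bdd_mul (M.measurable_toFun v).aestronglyMeasurable
    ((ae_restrict_iff' M.measurableSet_dom).2 (.of_forall fun z hz => M.norm_toFun_le v hz))

lemma load_sum_smul (hf : MemLp f 2 (volume.restrict M.dom)) {ι : Type*} [Fintype ι]
    (c : ι → ℝ) (u : ι → M.Broken) :
    M.load f (∑ k, c k • u k) = ∑ k, c k * M.load f (u k) := by
  simp only [load, toFun_sum_smul, Finset.mul_sum, mul_left_comm (f _)]
  rw [integral_finsetSum _ fun k _ => (integrable_mul_toFun hf (u k)).const_mul (c k)]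
  simp only [integral_const_mul]

lemma load_const (h1 : 0 < ℓ₁) (h2 : 0 < ℓ₂) (a : ℝ) :
    M.load f (fun _ => (a, 0, 0)) = a * ∫ z in M.dom, f z := by
  rw [load, ← integral_const_mul]
  refine integral_congr_ae ?_
  filter_upwards [M.ae_exists_mem_cellSet h1 h2] with z ⟨K, hK⟩
  rw [M.toFun_of_mem h1 h2 _ hK]
  simp [evalP1, mul_comm]

/-- The loads of the node-based functions of one colour sum up to zero. -/
lemma sum_color_loadB (h1 : 0 < ℓ₁) (h2 : 0 < ℓ₂) (hNx : Even M.Nx) (hNy : Even M.Ny)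
    (hf : MemLp f 2 (volume.restrict M.dom)) (hf0 : ∫ z in M.dom, f z = 0) (a : M.Node) :
    ∑ z, (if M.color z = M.color a then 1 else 0) * M.loadB f z = 0 := by
  have := M.combB_color hNx hNy a
  rw [combB] at this
  rw [show M.loadB f = fun z => M.load f (M.nodeFun z) from rfl, ← load_sum_smul hf, this,
    load_const h1 h2, hf0, mul_zero]

lemma toReal_rpow_half_volume (h1 : 0 < ℓ₁) (h2 : 0 < ℓ₂) :
    (volume.restrict M.dom Set.univ ^ (1 / 2 : ℝ)).toReal = Real.sqrt (ℓ₁ * ℓ₂) := by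
  rw [Measure.restrict_apply_univ, M.volume_dom h1, ← ENNReal.toReal_rpow,
    ENNReal.toReal_ofReal (by positivity), Real.sqrt_eq_rpow]

/-- The load of a function bounded by `1`. -/
lemma abs_load_le (h1 : 0 < ℓ₁) (h2 : 0 < ℓ₂) (hf : MemLp f 2 (volume.restrict M.dom))
    {v : M.Broken} (hv : ∀ K, ∀ z ∈ M.cellSet K, |evalP1 (v K) z| ≤ 1) :
    |M.load f v| ≤ Real.sqrt (ℓ₁ * ℓ₂) * M.normL2 f := by
  have hle : |M.load f v| ≤ ∫ z in M.dom, ‖f z‖ := by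
    rw [load, ← Real.norm_eq_abs]
    refine norm_integral_le_of_norm_le (hf.integrable one_le_two).norm ?_
    filter_upwards [M.ae_exists_mem_cellSet h1 h2] with z ⟨K, hK⟩
    rw [M.toFun_of_mem h1 h2 _ hK, norm_mul]
    exact mul_le_of_le_one_right (norm_nonneg _) (hv K z hK)
  -- Comparing the `L¹` and `L²` norms on a set of finite measure supplies the factor `|Ω|^(1/2)`.
  have h12 := eLpNorm_le_eLpNorm_mul_rpow_measure_univ (μ := volume.restrict M.dom)
    (p := 1) (q := 2) one_le_two hf.1
  rw [integral_norm_eq_lintegral_enorm hf.1, ← eLpNorm_one_eq_lintegral_enorm] at hle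
  refine hle.trans ?_
  have hr : (1 / (1 : ENNReal).toReal - 1 / (2 : ENNReal).toReal) = (1 / 2 : ℝ) := by norm_num
  rw [hr] at h12
  have := ENNReal.toReal_mono (ENNReal.mul_ne_top hf.2.ne
    (ENNReal.rpow_ne_top_of_nonneg (by norm_num) (measure_ne_top _ _))) h12
  rwa [ENNReal.toReal_mul, toReal_rpow_half_volume h1 h2, mul_comm] at this

/-- The `L²` norm of a bounded function. -/
lemma normL2_toFun_le (h1 : 0 < ℓ₁) (h2 : 0 < ℓ₂) {v : M.Broken} {B : ℝ} (hB : 0 ≤ B)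
    (hv : ∀ K, ∀ z ∈ M.cellSet K, |evalP1 (v K) z| ≤ B) :
    M.normL2 (M.toFun v) ≤ Real.sqrt (ℓ₁ * ℓ₂) * B := by
  have hae : ∀ᵐ z ∂(volume.restrict M.dom), ‖M.toFun v z‖ ≤ B := by
    filter_upwards [M.ae_exists_mem_cellSet h1 h2] with z ⟨K, hK⟩
    rw [M.toFun_of_mem h1 h2 _ hK]
    exact hv K z hK
  have h := eLpNorm_le_of_ae_bound (p := 2) hae
  have hr : ((2 : ENNReal).toReal)⁻¹ = (1 / 2 : ℝ) := by norm_num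
  rw [hr] at h
  have := ENNReal.toReal_mono (ENNReal.mul_ne_top
    (ENNReal.rpow_ne_top_of_nonneg (by norm_num) (measure_ne_top _ _)) ENNReal.ofReal_ne_top) h
  rwa [ENNReal.toReal_mul, toReal_rpow_half_volume h1 h2, ENNReal.toReal_ofReal hB] at this

end Load

/-! ### The alternating functions -/

/-- The mesh widths as a family. -/
def width : Fin 2 → ℝ := ![M.hx, M.hy]

lemma width_pos (h1 : 0 < ℓ₁) (h2 : 0 < ℓ₂) (k : Fin 2) : 0 < M.width k := by
  fin_cases k
  · exact M.hx_pos h1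
  · exact M.hy_pos h2

lemma psiX_apply (hNx : Even M.Nx) (K : M.Cell) :
    M.psiX K = ((-1) ^ ((K.1 : ℕ) + (K.2 : ℕ)) * 2 / M.hx * (((K.1 : ℕ) + 1 / 2) * M.hx),
      -((-1) ^ ((K.1 : ℕ) + (K.2 : ℕ)) * 2 / M.hx), 0) := by
  simp only [psiX, ofMidpoints, pow_add, neg_one_pow_fin_add_one hNx]
  ext <;> simp <;> ring

lemma psiY_apply (hNy : Even M.Ny) (K : M.Cell) :
    M.psiY K = ((-1) ^ ((K.1 : ℕ) + (K.2 : ℕ)) * 2 / M.hy * (((K.2 : ℕ) + 1 / 2) * M.hy),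
      0, -((-1) ^ ((K.1 : ℕ) + (K.2 : ℕ)) * 2 / M.hy)) := by
  simp only [psiY, ofMidpoints, pow_add, neg_one_pow_fin_add_one hNy]
  ext <;> simp <;> ring

/-- Up to sign the expression is `((2m + 1) h - 2x) / h`, which falls from `1` to `-1` across the
strip. -/
lemma abs_alternating_le {h x : ℝ} (hh : 0 < h) {m n : ℕ}
    (hx : x ∈ Set.Ioo (m * h) ((m + 1) * h)) :
    |(-1) ^ n * 2 / h * ((m + 1 / 2) * h) + -((-1) ^ n * 2 / h) * x| ≤ 1 := by
  have e : (-1) ^ n * 2 / h * ((m + 1 / 2) * h) + -((-1) ^ n * 2 / h) * x =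
      (-1) ^ n * (((2 * m + 1) * h - 2 * x) / h) := by field_simp; ring
  rw [e, abs_mul, abs_pow, abs_neg, abs_one, one_pow, one_mul, abs_div, abs_of_pos hh,
    div_le_one hh, abs_le]
  constructor <;> nlinarith [hx.1, hx.2]

lemma abs_evalP1_psi_le (h1 : 0 < ℓ₁) (h2 : 0 < ℓ₂) (hNx : Even M.Nx) (hNy : Even M.Ny)
    (k : Fin 2) (K : M.Cell) (z : ℝ × ℝ) (hz : z ∈ M.cellSet K) :
    |evalP1 (M.psi k K) z| ≤ 1 := by
  fin_cases k
  · simpa [psi, evalP1, M.psiX_apply hNx] using abs_alternating_le (M.hx_pos h1) hz.1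
  · simpa [psi, evalP1, M.psiY_apply hNy] using abs_alternating_le (M.hy_pos h2) hz.2

/-- `ψ_x` has slope `±2 / hx` in `x` only and `ψ_y` slope `±2 / hy` in `y` only. The mixed entries
vanish, and the squared slopes are constant over the domain. -/
lemma stiffA_eq (h1 : 0 < ℓ₁) (h2 : 0 < ℓ₂) (hNx : Even M.Nx) (hNy : Even M.Ny) :
    M.stiffA = Matrix.diagonal fun k => 4 * (ℓ₁ * ℓ₂) / M.width k ^ 2 := by
  have hx := (M.hx_pos h1).ne'
  have hy := (M.hy_pos h2).ne'
  have hs : ∀ (n : ℕ) (h : ℝ), -((-1) ^ n * 2 / h) * -((-1) ^ n * 2 / h) = 4 / h ^ 2 := by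
    intro n h
    have : ((-1 : ℝ) ^ n) ^ 2 = 1 := by rw [← pow_mul, mul_comm, pow_mul]; simp
    rw [neg_mul_neg, div_mul_div_comm, mul_mul_mul_comm, ← sq, this, sq]
    norm_num
  ext j k
  rw [stiffA, Matrix.of_apply, M.energy_eq h1 h2]
  fin_cases j <;> fin_cases k <;>
    simp only [psi, M.psiX_apply hNx, M.psiY_apply hNy, Matrix.cons_val_zero, Matrix.cons_val_one,
      Fin.zero_eta, Fin.mk_one, mul_zero, zero_mul, add_zero, zero_add, hs, Finset.sum_const,
      Finset.card_univ, Fintype.card_prod, Fintype.card_fin, smul_zero, nsmul_eq_mul,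
      Nat.cast_mul, Matrix.diagonal_apply_eq, width, ← M.Nx_mul_hx, ← M.Ny_mul_hy]
  · ring
  · simp
  · simp
  · ring

lemma stiffA_mulVec (h1 : 0 < ℓ₁) (h2 : 0 < ℓ₂) (hNx : Even M.Nx) (hNy : Even M.Ny)
    (d : Fin 2 → ℝ) (k : Fin 2) :
    (M.stiffA *ᵥ d) k = 4 * (ℓ₁ * ℓ₂) / M.width k ^ 2 * d k := by
  rw [M.stiffA_eq h1 h2 hNx hNy, Matrix.mulVec_diagonal]

lemma stiffA_isSymm : M.stiffA.IsSymm := by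
  ext j k
  exact M.energy_comm _ _

lemma stiffA_mulVec_injective (h1 : 0 < ℓ₁) (h2 : 0 < ℓ₂) (hNx : Even M.Nx) (hNy : Even M.Ny) :
    Function.Injective M.stiffA.mulVec := by
  intro d e h
  funext k
  have hk := congrFun h k
  simp only [M.stiffA_mulVec h1 h2 hNx hNy] at hk
  have := M.width_pos h1 h2 k
  exact mul_left_cancel₀ (by positivity) hk

lemma energy_sum_psi (h1 : 0 < ℓ₁) (h2 : 0 < ℓ₂) (hNx : Even M.Nx) (hNy : Even M.Ny)
    (d : Fin 2 → ℝ) :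
    M.energy (∑ k, d k • M.psi k) (∑ k, d k • M.psi k) =
      ∑ k, 4 * (ℓ₁ * ℓ₂) / M.width k ^ 2 * d k ^ 2 := by
  rw [M.energy_sum_smul h1 h2]
  refine Finset.sum_congr rfl fun k _ => ?_
  rw [energy_comm, M.energy_sum_smul h1 h2]
  have := M.stiffA_mulVec h1 h2 hNx hNy d k
  simp only [Matrix.mulVec, dotProduct, stiffA, Matrix.of_apply] at this
  simp only [mul_comm (d _) (M.energy _ _), this]
  ring

/-! ### Estimates for the contribution of the alternating functions -/

section Estimates

variable {M} {f : ℝ × ℝ → ℝ}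

lemma normL2_nonneg (g : ℝ × ℝ → ℝ) : 0 ≤ M.normL2 g := ENNReal.toReal_nonneg

lemma abs_coeff_psi_le (h1 : 0 < ℓ₁) (h2 : 0 < ℓ₂) (hNx : Even M.Nx) (hNy : Even M.Ny)
    (hf : MemLp f 2 (volume.restrict M.dom)) {d : Fin 2 → ℝ}
    (hd : M.stiffA *ᵥ d = M.loadA f) (k : Fin 2) :
    Real.sqrt (ℓ₁ * ℓ₂) * |d k| ≤ M.width k ^ 2 / 4 * M.normL2 f := by
  have hk := congrFun hd k
  rw [M.stiffA_mulVec h1 h2 hNx hNy] at hk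
  have hl : |M.loadA f k| ≤ _ := abs_load_le h1 h2 hf (M.abs_evalP1_psi_le h1 h2 hNx hNy k)
  have hw := M.width_pos h1 h2 k
  have hs : 0 < Real.sqrt (ℓ₁ * ℓ₂) := Real.sqrt_pos.2 (by positivity)
  have hss : Real.sqrt (ℓ₁ * ℓ₂) * Real.sqrt (ℓ₁ * ℓ₂) = ℓ₁ * ℓ₂ :=
    Real.mul_self_sqrt (by positivity)
  rw [← hk, abs_mul, abs_of_pos (by positivity)] at hl
  -- One factor `|Ω|^(1/2)` is split off `|Ω|` to cancel the one in the load bound.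
  have e : 4 * (ℓ₁ * ℓ₂) / M.width k ^ 2 * |d k| =
      Real.sqrt (ℓ₁ * ℓ₂) * (Real.sqrt (ℓ₁ * ℓ₂) * |d k| / (M.width k ^ 2 / 4)) := by
    field_simp
    rw [sq, hss]
    ring
  rw [e] at hl
  have := le_of_mul_le_mul_left hl hs
  rw [div_le_iff₀ (by positivity)] at this
  linarith

lemma normL2_sum_psi_le (h1 : 0 < ℓ₁) (h2 : 0 < ℓ₂) (hNx : Even M.Nx) (hNy : Even M.Ny)
    (hf : MemLp f 2 (volume.restrict M.dom)) {d : Fin 2 → ℝ}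
    (hd : M.stiffA *ᵥ d = M.loadA f) {h : ℝ} (hh : M.diam ≤ h) :
    M.normL2 (M.toFun (∑ k, d k • M.psi k)) ≤ 1 * h ^ 2 * M.normL2 f := by
  obtain ⟨h0, hle⟩ := M.hx_sq_add_hy_sq_le hh
  have hB : ∀ K, ∀ z ∈ M.cellSet K, |evalP1 ((∑ k, d k • M.psi k) K) z| ≤ ∑ k, |d k| := by
    intro K z hz
    rw [← M.toFun_of_mem h1 h2 _ hz, toFun_sum_smul]
    refine (Finset.abs_sum_le_sum_abs _ _).trans (Finset.sum_le_sum fun k _ => ?_)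
    rw [abs_mul, M.toFun_of_mem h1 h2 _ hz]
    exact mul_le_of_le_one_right (abs_nonneg _) (M.abs_evalP1_psi_le h1 h2 hNx hNy k K z hz)
  refine (normL2_toFun_le h1 h2 (Finset.sum_nonneg fun _ _ => abs_nonneg _) hB).trans ?_
  have a := abs_coeff_psi_le h1 h2 hNx hNy hf hd 0
  have b := abs_coeff_psi_le h1 h2 hNx hNy hf hd 1
  simp only [width, Matrix.cons_val_zero, Matrix.cons_val_one] at a b
  rw [Fin.sum_univ_two, mul_add]
  -- The two coefficient bounds add up to `(hx² + hy²) / 4 ≤ h² / 4` times `‖f‖`, so the constant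
  -- `1` leaves room.
  nlinarith [M.normL2_nonneg f, mul_le_mul_of_nonneg_right hle (M.normL2_nonneg f),
    mul_nonneg (sq_nonneg h) (M.normL2_nonneg f)]

lemma seminormH1_sum_psi_le (h1 : 0 < ℓ₁) (h2 : 0 < ℓ₂) (hNx : Even M.Nx) (hNy : Even M.Ny)
    (hf : MemLp f 2 (volume.restrict M.dom)) {d : Fin 2 → ℝ}
    (hd : M.stiffA *ᵥ d = M.loadA f) {h : ℝ} (hh : M.diam ≤ h) :
    M.seminormH1 (∑ k, d k • M.psi k) ≤ 1 * h * M.normL2 f := by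
  obtain ⟨h0, hle⟩ := M.hx_sq_add_hy_sq_le hh
  have hF := M.normL2_nonneg f
  refine Real.sqrt_le_iff.2 ⟨by positivity, ?_⟩
  rw [M.energy_sum_psi h1 h2 hNx hNy]
  have key : ∀ k, 4 * (ℓ₁ * ℓ₂) / M.width k ^ 2 * d k ^ 2 ≤
      M.width k ^ 2 / 4 * M.normL2 f ^ 2 := by
    intro k
    have hw := M.width_pos h1 h2 k
    have a := pow_le_pow_left₀ (by positivity) (abs_coeff_psi_le h1 h2 hNx hNy hf hd k) 2
    rw [mul_pow, Real.sq_sqrt (by positivity), sq_abs] at a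
    calc _ = ℓ₁ * ℓ₂ * d k ^ 2 * (4 / M.width k ^ 2) := by ring
      _ ≤ (M.width k ^ 2 / 4 * M.normL2 f) ^ 2 * (4 / M.width k ^ 2) := by gcongr
      _ = _ := by field_simp
  refine (Finset.sum_le_sum fun k _ => key k).trans ?_
  rw [Fin.sum_univ_two]
  simp only [width, Matrix.cons_val_zero, Matrix.cons_val_one]
  nlinarith [mul_le_mul_of_nonneg_right hle (sq_nonneg (M.normL2 f)),
    mul_nonneg (sq_nonneg h) (sq_nonneg (M.normL2 f))]

end Estimates

/-! ### Coefficient vectors on `𝔅♭` -/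

/-- Extension of a coefficient vector on `𝔅♭` by zero at the node `r`. -/
def extendZero (r : M.Node) (c : M.FlatNode r → ℝ) : M.Node → ℝ :=
  fun z => if h : z ≠ r then c ⟨z, h⟩ else 0

section ExtendZero

variable {M} {r : M.Node}

lemma extendZero_self (c : M.FlatNode r → ℝ) : M.extendZero r c r = 0 := by
  simp [extendZero]

lemma extendZero_coe (c : M.FlatNode r → ℝ) (z : M.FlatNode r) : M.extendZero r c z = c z := by
  simp [extendZero, z.2]

/-- The device for passing between `𝔅♭` and `𝔅`: the term of the omitted node must vanish. -/
lemma sum_flatNode {E : Type*} [AddCommMonoid E] {F : M.FlatNode r → E} {G : M.Node → E}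
    (h0 : G r = 0) (hFG : ∀ z : M.FlatNode r, F z = G z) : ∑ z, F z = ∑ z, G z := by
  refine Fintype.sum_of_injective Subtype.val Subtype.val_injective F G (fun z hz => ?_) hFG
  have : z = r := by
    by_contra hne
    exact hz ⟨⟨z, hne⟩, rfl⟩
  rw [this, h0]

lemma sum_extendZero (c : M.FlatNode r → ℝ) : ∑ z, M.extendZero r c z = ∑ z, c z :=
  (sum_flatNode (extendZero_self c) fun z => (extendZero_coe c z).symm).symm

lemma combBFlat_eq (c : M.FlatNode r → ℝ) : M.combBFlat r c = M.combB (M.extendZero r c) :=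
  sum_flatNode (by rw [extendZero_self, zero_smul]) fun z => by rw [extendZero_coe]

lemma combEFlat_eq (c : M.FlatNode r ⊕ Fin 2 → ℝ) :
    M.combEFlat r c = M.combE (Sum.elim (M.extendZero r (c ∘ Sum.inl)) (c ∘ Sum.inr)) := by
  simp [combEFlat, combE, combBFlat_eq]

/-- A zero coefficient at `r` removes the column of `r`, so the `𝔅♭`-system is the `𝔅`-system
without the row of `r`. -/
lemma stiffFlat_mulVec (c : M.FlatNode r → ℝ) (j : M.FlatNode r) :
    (M.stiffFlat r *ᵥ c) j = (M.stiffB *ᵥ M.extendZero r c) j :=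
  sum_flatNode (G := fun z => M.stiffB j z * M.extendZero r c z)
    (by simp [extendZero_self]) fun z => by simp [extendZero_coe, stiffFlat, stiffB]

lemma stiffFlatMod_mulVec_of_ne (c : M.FlatNode r → ℝ) {s j : M.FlatNode r} (hj : j ≠ s) :
    (M.stiffFlatMod r s *ᵥ c) j = (M.stiffB *ᵥ M.extendZero r c) j := by
  rw [← stiffFlat_mulVec]
  simp [Matrix.mulVec, dotProduct, stiffFlatMod, stiffFlat, hj]

lemma stiffFlatMod_mulVec_self (c : M.FlatNode r → ℝ) (s : M.FlatNode r) :
    (M.stiffFlatMod r s *ᵥ c) s = ∑ z, M.extendZero r c z := by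
  rw [sum_extendZero]
  simp [Matrix.mulVec, dotProduct, stiffFlatMod]

lemma stiffFlat_isSymm : (M.stiffFlat r).IsSymm := by
  ext j k
  exact M.energy_comm _ _

lemma sysFlat_isSymm : (M.sysFlat r).IsSymm :=
  Matrix.IsSymm.fromBlocks stiffFlat_isSymm (by simp) M.stiffA_isSymm

lemma sysE_isSymm : M.sysE.IsSymm :=
  Matrix.IsSymm.fromBlocks M.stiffB_isSymm (by simp) M.stiffA_isSymm

end ExtendZero

/-! ### Block systems -/

lemma fromBlocks_diagonal_mulVec_eq_iff {m n : Type*} [Fintype m] [Fintype n]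
    {A : Matrix m m ℝ} {D : Matrix n n ℝ} {c : m ⊕ n → ℝ} {a : m → ℝ} {d : n → ℝ} :
    Matrix.fromBlocks A 0 0 D *ᵥ c = Sum.elim a d ↔
      A *ᵥ (c ∘ Sum.inl) = a ∧ D *ᵥ (c ∘ Sum.inr) = d := by
  rw [Matrix.fromBlocks_mulVec, Matrix.zero_mulVec, Matrix.zero_mulVec, add_zero, zero_add,
    Sum.elim_eq_iff]

/-! ### Existence, uniqueness and equivalence of the discrete solutions. -/

section Options

variable {M} {f : ℝ × ℝ → ℝ} {r : M.Node}

/-- If all the entries of one colour but one vanish and their sum does, all of them vanish. -/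
lemma eq_zero_of_sum_color {D : M.Node → ℝ} {a : M.Node}
    (hs : ∑ z, (if M.color z = M.color a then 1 else 0) * D z = 0)
    (h0 : ∀ z, z ≠ a → M.color z = M.color a → D z = 0) : D a = 0 := by
  rw [Finset.sum_eq_single a] at hs
  · simpa using hs
  · intro z _ hz
    split_ifs with hc
    · rw [h0 z hz hc, mul_zero]
    · rw [zero_mul]
  · simp

/-- For compatible data, the equations of all nodes follow if one equation is dropped for each
colour. -/
lemma stiffB_mulVec_eq_of_forall_ne (h1 : 0 < ℓ₁) (h2 : 0 < ℓ₂) (hNx : Even M.Nx)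
    (hNy : Even M.Ny) {b x : M.Node → ℝ}
    (hb : ∀ a, ∑ z, (if M.color z = M.color a then 1 else 0) * b z = 0)
    {s : M.Node} (hsr : M.color s ≠ M.color r)
    (h : ∀ j, j ≠ r → j ≠ s → (M.stiffB *ᵥ x) j = b j) : M.stiffB *ᵥ x = b := by
  have hD : ∀ a, ∑ z, (if M.color z = M.color a then 1 else 0) * (M.stiffB *ᵥ x - b) z = 0 := by
    intro a
    simp only [Pi.sub_apply, mul_sub, Finset.sum_sub_distrib, hb a, sub_zero]
    exact M.sum_color_stiffB_mulVec h1 h2 hNx hNy x a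
  have hr : (M.stiffB *ᵥ x - b) r = 0 := eq_zero_of_sum_color (hD r) fun z hz hc =>
    sub_eq_zero.2 (h z hz fun e => hsr (e ▸ hc))
  have hs : (M.stiffB *ᵥ x - b) s = 0 := eq_zero_of_sum_color (hD s) fun z hz hc =>
    sub_eq_zero.2 (h z (fun e => hsr (e ▸ hc.symm)) hz)
  funext j
  by_cases hjr : j = r
  · rw [hjr]; exact sub_eq_zero.1 hr
  by_cases hjs : j = s
  · rw [hjs]; exact sub_eq_zero.1 hs
  exact h j hjr hjs

/-- A kernel vector, extended by zero, satisfies all equations of `stiffB` and so depends on the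
colour only. It vanishes on the colour of `r` by the extension, and then on the other colour because
the row of `s` makes its sum zero. -/
lemma stiffFlatMod_mulVec_injective (h1 : 0 < ℓ₁) (h2 : 0 < ℓ₂) (hNx : Even M.Nx)
    (hNy : Even M.Ny) {s : M.FlatNode r} (hsr : M.color s.1 ≠ M.color r) :
    Function.Injective (M.stiffFlatMod r s).mulVec := by
  refine (injective_iff_map_eq_zero (M.stiffFlatMod r s).mulVecLin).2 fun c hc => ?_
  rw [Matrix.mulVecLin_apply] at hc
  have hS : M.stiffB *ᵥ M.extendZero r c = 0 := by
    refine stiffB_mulVec_eq_of_forall_ne h1 h2 hNx hNy (by simp) hsr fun j hjr hjs => ?_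
    rw [← stiffFlatMod_mulVec_of_ne (s := s) (j := ⟨j, hjr⟩) c fun e => hjs (congrArg Subtype.val e), hc]
    rfl
  have hsum : ∑ z, M.extendZero r c z = 0 := by
    rw [← stiffFlatMod_mulVec_self c s, hc, Pi.zero_apply]
  have hsl := M.slopes_eq_zero_of_stiffB_mulVec h1 h2 hS
  funext z
  rw [← extendZero_coe c z, Pi.zero_apply]
  by_cases hz : M.color z.1 = M.color r
  · rw [M.eq_of_color_eq h1 h2 hNx hNy hsl hz, extendZero_self]
  · have := M.add_eq_of_color_ne h1 h2 hNx hNy hsl hz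
    rwa [hsum, zero_div, mul_zero, extendZero_self, add_zero] at this

lemma exists_isOption1 (h1 : 0 < ℓ₁) (h2 : 0 < ℓ₂) (hNx : Even M.Nx) (hNy : Even M.Ny)
    {s : M.FlatNode r} (hsr : M.color s.1 ≠ M.color r) : ∃ u, M.IsOption1 f r s u := by
  have surj : ∀ {ι : Type} [Fintype ι] [DecidableEq ι] {A : Matrix ι ι ℝ},
      Function.Injective A.mulVec → Function.Surjective A.mulVec := fun {ι} _ _ {A} h =>
    Matrix.mulVec_surjective_iff_isUnit.2 (Matrix.mulVec_injective_iff_isUnit.1 h)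
  obtain ⟨c, hc⟩ := surj (stiffFlatMod_mulVec_injective h1 h2 hNx hNy hsr)
    (fun z => if z = s then 0 else M.load f (M.nodeFun z))
  obtain ⟨d, hd⟩ := surj (M.stiffA_mulVec_injective h1 h2 hNx hNy) (M.loadA f)
  exact ⟨_, Sum.elim c d, fromBlocks_diagonal_mulVec_eq_iff.2 ⟨hc, hd⟩, rfl⟩

/-- The missing equations at `r` and `s` follow from the others, one for each colour. -/
lemma IsOption1.isOption2 (h1 : 0 < ℓ₁) (h2 : 0 < ℓ₂) (hNx : Even M.Nx) (hNy : Even M.Ny)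
    (hf : MemLp f 2 (volume.restrict M.dom)) (hf0 : ∫ z in M.dom, f z = 0)
    {s : M.FlatNode r} (hsr : M.color s.1 ≠ M.color r) {u : M.Broken}
    (hu : M.IsOption1 f r s u) : M.IsOption2 f r u := by
  obtain ⟨c, hc, rfl⟩ := hu
  obtain ⟨hcB, hcA⟩ := fromBlocks_diagonal_mulVec_eq_iff.1 hc
  have hS : M.stiffB *ᵥ M.extendZero r (c ∘ Sum.inl) = M.loadB f := by
    refine stiffB_mulVec_eq_of_forall_ne h1 h2 hNx hNy
      (sum_color_loadB h1 h2 hNx hNy hf hf0) hsr fun j hjr hjs => ?_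
    have hj : (⟨j, hjr⟩ : M.FlatNode r) ≠ s := fun e => hjs (congrArg Subtype.val e)
    rw [← stiffFlatMod_mulVec_of_ne (s := s) (j := ⟨j, hjr⟩) _ hj, hcB]
    simp [hj, loadB]
  refine ⟨c, fromBlocks_diagonal_mulVec_eq_iff.2 ⟨?_, hcA⟩, ?_, rfl⟩
  · funext j
    rw [stiffFlat_mulVec, hS]
    rfl
  -- The row of ones against the load entry `0` at `s` is exactly the zero-sum condition.
  · have := stiffFlatMod_mulVec_self (c ∘ Sum.inl) s
    rw [hcB, sum_extendZero] at this
    simpa using this.symm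

lemma IsOption2.isOption3 (h1 : 0 < ℓ₁) (h2 : 0 < ℓ₂) (hNx : Even M.Nx) (hNy : Even M.Ny)
    (hf : MemLp f 2 (volume.restrict M.dom)) (hf0 : ∫ z in M.dom, f z = 0)
    {s : M.FlatNode r} (hsr : M.color s.1 ≠ M.color r) {u : M.Broken}
    (hu : M.IsOption2 f r u) : M.IsOption3 f u := by
  obtain ⟨c, hc, hc0, rfl⟩ := hu
  obtain ⟨hcB, hcA⟩ := fromBlocks_diagonal_mulVec_eq_iff.1 hc
  refine ⟨Sum.elim (M.extendZero r (c ∘ Sum.inl)) (c ∘ Sum.inr),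
    fromBlocks_diagonal_mulVec_eq_iff.2 ⟨?_, hcA⟩, ?_, combEFlat_eq c⟩
  · refine stiffB_mulVec_eq_of_forall_ne h1 h2 hNx hNy
      (sum_color_loadB h1 h2 hNx hNy hf hf0) hsr fun j hjr _ => ?_
    rw [Sum.elim_comp_inl, ← stiffFlat_mulVec _ ⟨j, hjr⟩, hcB]
    rfl
  · simpa only [Sum.elim_inl, sum_extendZero, Function.comp_apply] using hc0

/-- Uniqueness holds for functions, not for coefficients: the difference of the two colour
indicators has sum zero and represents the zero function. -/
lemma IsOption3.unique (h1 : 0 < ℓ₁) (h2 : 0 < ℓ₂) (hNx : Even M.Nx) (hNy : Even M.Ny)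
    {u v : M.Broken} (hu : M.IsOption3 f u) (hv : M.IsOption3 f v) : u = v := by
  obtain ⟨c, hc, hc0, rfl⟩ := hu
  obtain ⟨d, hd, hd0, rfl⟩ := hv
  obtain ⟨hcB, hcA⟩ := fromBlocks_diagonal_mulVec_eq_iff.1 hc
  obtain ⟨hdB, hdA⟩ := fromBlocks_diagonal_mulVec_eq_iff.1 hd
  have e := M.stiffA_mulVec_injective h1 h2 hNx hNy (hcA.trans hdA.symm)
  rw [combE, combE, M.combB_eq_of_stiffB_mulVec_eq h1 h2 hNx hNy (hcB.trans hdB.symm)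
    (hc0.trans hd0.symm)]
  congr 1
  exact Finset.sum_congr rfl fun k _ => by rw [show c (Sum.inr k) = d (Sum.inr k) from congrFun e k]

/-- Solutions of the `𝔅`-system with vanishing sum are the `𝔅`-parts of those of option 3. -/
lemma IsOption4.exists_coeff (h1 : 0 < ℓ₁) (h2 : 0 < ℓ₂) (hNx : Even M.Nx) (hNy : Even M.Ny)
    {u : M.Broken} (hu : M.IsOption4 f u) :
    ∃ c, M.stiffB *ᵥ c = M.loadB f ∧ ∑ z, c z = 0 ∧ u = M.combB c := by
  obtain ⟨c₀, c, hc₀, hc, rfl⟩ := hu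
  exact ⟨c, hc.1, (M.sum_stiffB_krylov h1 h2 hNx hNy hc).trans hc₀, rfl⟩

lemma IsOption4.unique (h1 : 0 < ℓ₁) (h2 : 0 < ℓ₂) (hNx : Even M.Nx) (hNy : Even M.Ny)
    {u v : M.Broken} (hu : M.IsOption4 f u) (hv : M.IsOption4 f v) : u = v := by
  obtain ⟨c, hc, hc0, rfl⟩ := hu.exists_coeff h1 h2 hNx hNy
  obtain ⟨d, hd, hd0, rfl⟩ := hv.exists_coeff h1 h2 hNx hNy
  exact M.combB_eq_of_stiffB_mulVec_eq h1 h2 hNx hNy (hc.trans hd.symm) (hc0.trans hd0.symm)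

lemma IsOption3.exists_isOption4 {u : M.Broken} (hu : M.IsOption3 f u) :
    ∃ v, M.IsOption4 f v := by
  obtain ⟨c, hc, -, -⟩ := hu
  obtain ⟨x, hx⟩ := exists_isKrylovSolution M.stiffB_isSymm
    (fromBlocks_diagonal_mulVec_eq_iff.1 hc).1 0
  exact ⟨_, 0, x, by simp, hx, rfl⟩

/-- The functions of options 3 and 4 differ by the contribution of the alternating functions. -/
lemma IsOption3.sub_isOption4 (h1 : 0 < ℓ₁) (h2 : 0 < ℓ₂) (hNx : Even M.Nx) (hNy : Even M.Ny)
    {u v : M.Broken} (hu : M.IsOption3 f u) (hv : M.IsOption4 f v) :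
    ∃ d, M.stiffA *ᵥ d = M.loadA f ∧ u - v = ∑ k, d k • M.psi k := by
  obtain ⟨c, hc, hc0, rfl⟩ := hu
  obtain ⟨hcB, hcA⟩ := fromBlocks_diagonal_mulVec_eq_iff.1 hc
  obtain ⟨e, he, he0, rfl⟩ := hv.exists_coeff h1 h2 hNx hNy
  refine ⟨c ∘ Sum.inr, hcA, ?_⟩
  rw [combE, M.combB_eq_of_stiffB_mulVec_eq h1 h2 hNx hNy (hcB.trans he.symm)
    (hc0.trans he0.symm), add_sub_cancel_left]
  rfl

lemma IsOption3Scheme.isOption3 (h1 : 0 < ℓ₁) (h2 : 0 < ℓ₂) (hNx : Even M.Nx) (hNy : Even M.Ny)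
    {u : M.Broken} (hu : M.IsOption3Scheme f u) : M.IsOption3 f u := by
  obtain ⟨c₀, c, hc₀, hc, rfl⟩ := hu
  refine ⟨c, hc.1, ?_, rfl⟩
  have hk : M.sysE *ᵥ Sum.elim (fun _ => 1) 0 = 0 := by
    rw [← Sum.elim_zero_zero]
    exact fromBlocks_diagonal_mulVec_eq_iff.2
      ⟨M.stiffB_mulVec_of_const h1 h2 (M.combB_one hNx hNy), Matrix.mulVec_zero _⟩
  have := hc.dotProduct_eq sysE_isSymm hk
  simpa [dotProduct, hc₀] using this

lemma IsOption3.isOption3Scheme (h1 : 0 < ℓ₁) (h2 : 0 < ℓ₂) (hNx : Even M.Nx) (hNy : Even M.Ny)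
    {u : M.Broken} (hu : M.IsOption3 f u) : M.IsOption3Scheme f u := by
  obtain ⟨c, hc, -, -⟩ := id hu
  obtain ⟨x, hx⟩ := exists_isKrylovSolution sysE_isSymm hc 0
  have hs : M.IsOption3Scheme f (M.combE x) := ⟨0, x, by simp, hx, rfl⟩
  rwa [hu.unique h1 h2 hNx hNy (hs.isOption3 h1 h2 hNx hNy)]

/-- The constant function `1` is a combination of `𝔅♭`. -/
lemma exists_combBFlat_eq_one (hNx : Even M.Nx) (hNy : Even M.Ny) {s : M.FlatNode r}
    (hsr : M.color s.1 ≠ M.color r) : ∃ w, M.combBFlat r w = fun _ => (1, 0, 0) := by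
  -- Twice the indicator of the colour of `s` represents `1`. It vanishes at `r`, which has the
  -- other colour, so it uses `𝔅♭` only.
  refine ⟨fun z => 2 * (if M.color z.1 = M.color s.1 then 1 else 0), ?_⟩
  have e : M.extendZero r (fun z => 2 * (if M.color z.1 = M.color s.1 then 1 else 0)) =
      (2 : ℝ) • fun z => if M.color z = M.color s.1 then 1 else 0 := by
    funext z
    by_cases hz : z = r
    · subst hz; simp [extendZero, hsr.symm]
    · simp [extendZero, hz]
  have hsmul : ∀ (a : ℝ) (c : M.Node → ℝ), M.combB (a • c) = a • M.combB c := fun a c => by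
    simp [combB, Finset.smul_sum, mul_smul]
  rw [combBFlat_eq, e, hsmul, M.combB_color hNx hNy]
  funext K
  simp

/-- The constant represented is the mean coefficient, so this sum is a legitimate divisor in the
post-processing. -/
lemma sum_ne_zero_of_combBFlat_eq_one (h1 : 0 < ℓ₁) (h2 : 0 < ℓ₂) (hNx : Even M.Nx)
    (hNy : Even M.Ny) {w : M.FlatNode r → ℝ} (hw : M.combBFlat r w = fun _ => (1, 0, 0)) :
    ∑ z, w z ≠ 0 := by
  rw [combBFlat_eq] at hw
  have h := M.combB_eq_const h1 h2 hNx hNy (c := M.extendZero r w) (by simp [hw])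
  rw [hw, sum_extendZero] at h
  intro h0
  -- The node `r` serves here as an element, both being index pairs of the same type; any element
  -- would do.
  have := congrArg Prod.fst (congrFun h r)
  simp [h0] at this

/-- Constants have zero energy with everything, so `w` is in the kernel and subtracting its multiple
keeps the equations. -/
lemma IsOption2Scheme.isOption2 (h1 : 0 < ℓ₁) (h2 : 0 < ℓ₂) (hNx : Even M.Nx) (hNy : Even M.Ny)
    {u : M.Broken} (hu : M.IsOption2Scheme f r u) : M.IsOption2 f r u := by
  obtain ⟨c₀, c, w, hc, hw, rfl⟩ := hu
  refine ⟨_, ?_, ?_, rfl⟩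
  · have hk : M.sysFlat r *ᵥ Sum.elim w 0 = 0 := by
      rw [← Sum.elim_zero_zero]
      refine fromBlocks_diagonal_mulVec_eq_iff.2 ⟨?_, Matrix.mulVec_zero _⟩
      funext j
      rw [Sum.elim_comp_inl, stiffFlat_mulVec,
        M.stiffB_mulVec_of_const h1 h2 ((combBFlat_eq w).symm.trans hw)]
      rfl
    rw [Matrix.mulVec_sub, Matrix.mulVec_smul, hk, smul_zero, sub_zero, hc.1]
  · have := sum_ne_zero_of_combBFlat_eq_one h1 h2 hNx hNy hw
    simp only [Pi.sub_apply, Pi.smul_apply, Sum.elim_inl, smul_eq_mul, Finset.sum_sub_distrib,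
      ← Finset.mul_sum]
    rw [div_mul_cancel₀ _ this, sub_self]

lemma IsOption2.isOption2Scheme (h1 : 0 < ℓ₁) (h2 : 0 < ℓ₂) (hNx : Even M.Nx) (hNy : Even M.Ny)
    (hf : MemLp f 2 (volume.restrict M.dom)) (hf0 : ∫ z in M.dom, f z = 0)
    {s : M.FlatNode r} (hsr : M.color s.1 ≠ M.color r) {u : M.Broken}
    (hu : M.IsOption2 f r u) : M.IsOption2Scheme f r u := by
  obtain ⟨c, hc, -, -⟩ := id hu
  obtain ⟨x, hx⟩ := exists_isKrylovSolution sysFlat_isSymm hc 0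
  obtain ⟨w, hw⟩ := exists_combBFlat_eq_one hNx hNy hsr
  have hs : M.IsOption2Scheme f r _ := ⟨0, x, w, hx, hw, rfl⟩
  -- The post-processed Krylov solution and `u` both satisfy option 3, where uniqueness identifies
  -- them.
  rwa [(hu.isOption3 h1 h2 hNx hNy hf hf0 hsr).unique h1 h2 hNx hNy
    ((hs.isOption2 h1 h2 hNx hNy).isOption3 h1 h2 hNx hNy hf hf0 hsr)]

end Options
end RectMesh

end

theorem theorem5p2 (ℓ₁ ℓ₂ : ℝ) (hℓ₁ : 0 < ℓ₁) (hℓ₂ : 0 < ℓ₂) :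
    ∃ C : ℝ, 0 < C ∧
      ∀ (M : RectMesh ℓ₁ ℓ₂), Even M.Nx → Even M.Ny →
      ∀ h : ℝ, M.diam ≤ h →
      ∀ (r : M.Node) (s : M.FlatNode r), M.color s.1 ≠ M.color r →
      ∀ f : ℝ × ℝ → ℝ, MemLp f 2 (volume.restrict M.dom) → ∫ z in M.dom, f z = 0 →
        (∃! u, M.IsOption1 f r s u) ∧ (∃! u, M.IsOption2 f r u) ∧
        (∃! u, M.IsOption3 f u) ∧ (∃! u, M.IsOption4 f u) ∧
        (∀ u, M.IsOption2 f r u ↔ M.IsOption2Scheme f r u) ∧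
        (∀ u, M.IsOption3 f u ↔ M.IsOption3Scheme f u) ∧
        ∀ u uFlat uNat uBar : M.Broken,
          M.IsOption1 f r s u → M.IsOption2 f r uFlat → M.IsOption3 f uNat → M.IsOption4 f uBar →
          u = uFlat ∧ uFlat = uNat ∧
          M.normL2 (M.toFun (uNat - uBar)) ≤ C * h ^ 2 * M.normL2 f ∧
          M.seminormH1 (uNat - uBar) ≤ C * h * M.normL2 f := by
  -- The factors `|Ω|^(1/2)` cancel in both estimates, so `C = 1` serves every rectangle.
  refine ⟨1, one_pos, fun M hNx hNy h hh r s hsr f hf hf0 => ?_⟩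
  have h12 {u} (hu : M.IsOption1 f r s u) : M.IsOption2 f r u :=
    hu.isOption2 hℓ₁ hℓ₂ hNx hNy hf hf0 hsr
  have h23 {u} (hu : M.IsOption2 f r u) : M.IsOption3 f u :=
    hu.isOption3 hℓ₁ hℓ₂ hNx hNy hf hf0 hsr
  have uniq {u v} (hu : M.IsOption3 f u) (hv : M.IsOption3 f v) : u = v :=
    hu.unique hℓ₁ hℓ₂ hNx hNy hv
  obtain ⟨u₁, hu₁⟩ := M.exists_isOption1 (f := f) hℓ₁ hℓ₂ hNx hNy hsr
  obtain ⟨u₄, hu₄⟩ := (h23 (h12 hu₁)).exists_isOption4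
  refine ⟨⟨u₁, hu₁, fun v hv => uniq (h23 (h12 hv)) (h23 (h12 hu₁))⟩,
    ⟨u₁, h12 hu₁, fun v hv => uniq (h23 hv) (h23 (h12 hu₁))⟩,
    ⟨u₁, h23 (h12 hu₁), fun v hv => uniq hv (h23 (h12 hu₁))⟩,
    ⟨u₄, hu₄, fun v hv => hv.unique hℓ₁ hℓ₂ hNx hNy hu₄⟩,
    fun u => ⟨fun hu => hu.isOption2Scheme hℓ₁ hℓ₂ hNx hNy hf hf0 hsr,
      fun hu => hu.isOption2 hℓ₁ hℓ₂ hNx hNy⟩,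
    fun u => ⟨fun hu => hu.isOption3Scheme hℓ₁ hℓ₂ hNx hNy,
      fun hu => hu.isOption3 hℓ₁ hℓ₂ hNx hNy⟩,
    fun u uFlat uNat uBar hu hFlat hNat hBar =>
      ⟨uniq (h23 (h12 hu)) (h23 hFlat), uniq (h23 hFlat) hNat, ?_⟩⟩
  obtain ⟨d, hd, hsub⟩ := hNat.sub_isOption4 hℓ₁ hℓ₂ hNx hNy hBar
  rw [hsub]
  exact ⟨RectMesh.normL2_sum_psi_le hℓ₁ hℓ₂ hNx hNy hf hd hh,
    RectMesh.seminormH1_sum_psi_le hℓ₁ hℓ₂ hNx hNy hf hd hh⟩
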